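/- **Setting.** Let $\mathbf X$ be a Hausdorff locally convex space over $\mathbb T\in\{\mathbb R,\mathbb C\}$, $\widetilde{\mathbf X}$ its completion, $\mathbf X^*$ its dual with the topology of uniform convergence on bounded sets, and $\mathcal L(\mathbf X)$ the continuous linear operators on $\mathbf X$. For $\mathrm F:[0,\infty)\to\mathcal L(\mathbf X)$: * The many-valued effective derivative $\mathrm F'_{mef}(0)$ assigns to $x$ the set of all $y\in\mathbf X$ for which there is a family $(x_s)_{s>0}$ with $x_s\to x$ and $s^{-1}(\mathrm F(s)-\mathrm F(0))x_s\to y$ as $s\downarrow0$; $\mathcal D(\mathrm F'_{mef}(0))$ is the set of $x$ for which this set is non-empty. If all these sets have at most one element, $\mathrm F'_{ef}(0)$ denotes the resulting linear operator with domain $\mathcal D(\mathrm F'_{mef}(0))$. * $\mathrm F\in\mathcal F_{\mathbf X}$ means: $\mathrm F(0)=\mathrm I$; for each $s\ge0$ the family $\{\mathrm F(d/n)^m : n,m\ge1,\ d\ge0,\ md/n\le s\}$ is equicontinuous; and $\mathcal D(\mathrm F'_{mef}(0))$ is dense in $\mathbf X$. * $\mathcal Z_{\mathbf X}$ is the set of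 densely defined linear operators $\mathrm Z$ in $\mathbf X$ for which there is $\mathrm G\in\mathcal F_{\mathbf X}$ with $\mathrm Zx\in\mathrm G'_{mef}(0)x$ for all $x\in\mathcal D(\mathrm Z)$. * $\mathrm F^*(s)=\mathrm F(s)^*$ on $\mathbf X^*$, and $\mathcal D({\mathrm F^*}'(0))$ is the set of $\phi\in\mathbf X^*$ for which $\lim_{s\downarrow0}s^{-1}(\mathrm F^*(s)\phi-\mathrm F^*(0)\phi)$ exists in $\mathbf X^*$. * A set $A\subset\mathbf X^*$ is *-dense in $\mathbf X^*$ if for each $\phi\in\mathbf X^*$ there is a sequence $\phi_k\in A$ with $\phi_k(x)\to\phi(x)$ for all $x\in\widetilde{\mathbf X}$ (functionals being extended by continuity). **Theorem 7.1.** Let $\mathrm Z\in\mathcal Z_{\mathbf X}$, $t>0$, $l>0$, $h\in\mathcal D(\mathrm Z)$, and let $\mathrm F\in\mathcal F_{\mathbf X}$ satisfy (i) $\mathcal D(\mathrm F'_{ef}(0))\supset\mathcal D(\mathrm Z)$ and $\mathrm F'_{ef}(0)g=\mathrm Zg$ for $g\in\mathcal D(\mathrm Z)$; (ii) $\mathcal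 D({\mathrm F^*}'(0))$ is *-dense in $\mathbf X^*$. Then $\mathrm F'_{ef}(0)$ is well defined (that is, $\mathrm F'_{mef}(0)$ is single-valued), $\mathrm Z$ is closable with closure $\overline{\mathrm Z}$, and there exists a local solution on $[0,l)$, that is, a function $f:[0,l)\to\mathbf X$ with $f(0)=h$, $f(v)\in\mathcal D(\overline{\mathrm Z})$ and $f'(v)=\overline{\mathrm Z}f(v)$ for all $v\in[0,l)$ (the derivative at $0$ being one-sided), if and only if both conditions hold: (a) for each $s\in[0,l)$, every subsequence of $\{\mathrm F(t/n)^{[ns/t]}h\}_{n\in\mathbb N}$ has a weakly convergent sub-subsequence; (b) for each $s\in[0,l)$ there is a sequence $f^s_n\in\mathcal D(\overline{\mathrm Z})$ such that $\mathrm F(t/n)^{[ns/t]}h-f^s_n\to0$ weakly and every subsequence of $\{\overline{\mathrm Z}f^s_n\}_{n\in\mathbb N}$ has a weakly convergent sub-subsequence. Moreover, if (a) and (b) hold, then every local solution $f$ on $[0,l)$ satisfies $$f(v)=\lim_{n\to\infty}\mathrm F(v/n)^n h,\qquad v\in[0,l).$$ -/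

import Mathlib

open Filter Topology
open scoped NNReal

noncomputable section

namespace ChernoffLCS

/-! Functions `F : [0,∞) → L(E)` are modelled as `F : ℝ≥0 → E →L[𝕜] E`, where `𝕜` is `ℝ` or `ℂ`. -/

section General

variable {𝕜 E : Type*} [RCLike 𝕜] [AddCommGroup E] [Module 𝕜 E]

/-- The difference quotient `s⁻¹ (F(s) - F(0)) x`. -/
def diffQuot [TopologicalSpace E] (F : ℝ≥0 → E →L[𝕜] E) (s : ℝ≥0) (x : E) : E :=
  (((s : ℝ) : 𝕜))⁻¹ • (F s x - F 0 x)

/-- The domain `D(F'(0))` of the strong derivative at `0`: all `x` for which the limit of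
`s⁻¹ (F(s) x - F(0) x)` as `s → 0` exists in `E`. -/
def strongDerivDomain [TopologicalSpace E] (F : ℝ≥0 → E →L[𝕜] E) : Set E :=
  {x | ∃ y : E, Tendsto (fun s : ℝ≥0 => diffQuot F s x) (𝓝[>] 0) (𝓝 y)}

/-- The graph of the many-valued effective derivative `F'_mef(0)`: all pairs `(x, y)` for which
there is a family `(x_s)` with `x_s → x` and `s⁻¹ (F(s) - F(0)) x_s → y` as `s → 0`. -/
def mefDerivGraph [TopologicalSpace E] [ContinuousAdd E] [ContinuousConstSMul 𝕜 E]
    (F : ℝ≥0 → E →L[𝕜] E) : Submodule 𝕜 (E × E) where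
  carrier := {p | ∃ x : ℝ≥0 → E, Tendsto x (𝓝[>] 0) (𝓝 p.1) ∧
    Tendsto (fun s : ℝ≥0 => diffQuot F s (x s)) (𝓝[>] 0) (𝓝 p.2)}
  zero_mem' := ⟨fun _ => 0, tendsto_const_nhds, by simpa [diffQuot] using tendsto_const_nhds⟩
  add_mem' := by
    rintro p q ⟨x, hx, hx'⟩ ⟨y, hy, hy'⟩
    refine ⟨fun s => x s + y s, hx.add hy, (hx'.add hy').congr fun s => ?_⟩
    simp only [diffQuot, map_add, ← smul_add]
    congr 1
    abel
  smul_mem' := by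
    rintro c p ⟨x, hx, hx'⟩
    refine ⟨fun s => c • x s, hx.const_smul c, (hx'.const_smul c).congr fun s => ?_⟩
    simp only [diffQuot, map_smul, ← smul_sub]
    rw [smul_comm]

/-- The domain `D(F'_mef(0))`. -/
def mefDerivDomain [TopologicalSpace E] [ContinuousAdd E] [ContinuousConstSMul 𝕜 E]
    (F : ℝ≥0 → E →L[𝕜] E) : Set E :=
  {x | ∃ y : E, (x, y) ∈ mefDerivGraph F}

/-- `F'_mef(0)` is single-valued, that is, the effective derivative `F'_ef(0)` exists. -/
def EffDerivExists [TopologicalSpace E] [ContinuousAdd E] [ContinuousConstSMul 𝕜 E]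
    (F : ℝ≥0 → E →L[𝕜] E) : Prop :=
  ∀ x y z : E, (x, y) ∈ mefDerivGraph F → (x, z) ∈ mefDerivGraph F → y = z

/-- The effective derivative `F'_ef(0)`: the partially defined linear operator with domain
`D(F'_mef(0))` and graph `mefDerivGraph F`. Meaningful when `EffDerivExists F`. -/
def effDeriv [TopologicalSpace E] [ContinuousAdd E] [ContinuousConstSMul 𝕜 E]
    (F : ℝ≥0 → E →L[𝕜] E) : E →ₗ.[𝕜] E :=
  (mefDerivGraph F).toLinearPMap

/-- The adjoint function `s ↦ F(s)^*` with values in the continuous operators on the strong dual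
`E^*` (Mathlib's `StrongDual` carries the topology of uniform convergence on bounded sets). -/
def adjointFun [TopologicalSpace E] [IsTopologicalAddGroup E] [ContinuousSMul 𝕜 E]
    (F : ℝ≥0 → E →L[𝕜] E) : ℝ≥0 → StrongDual 𝕜 E →L[𝕜] StrongDual 𝕜 E :=
  fun s => ContinuousLinearMap.precomp 𝕜 (F s)

/-- The family `B_s^F = {F(d/n)^m | m d / n ≤ s, n, m ≥ 1, d ≥ 0}`. -/
def chernoffFamily [TopologicalSpace E] (F : ℝ≥0 → E →L[𝕜] E) (s : ℝ≥0) : Set (E →L[𝕜] E) :=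
  {G | ∃ (n m : ℕ) (d : ℝ≥0), 0 < n ∧ 0 < m ∧ (m : ℝ≥0) * d / n ≤ s ∧ G = F (d / n) ^ m}

/-- Weak convergence of a sequence in `E`. -/
def WeakTendsto (𝕜 : Type*) {E : Type*} [RCLike 𝕜] [AddCommGroup E] [Module 𝕜 E]
    [TopologicalSpace E] (u : ℕ → E) (x : E) : Prop :=
  Tendsto (fun n => toWeakSpace 𝕜 E (u n)) atTop (𝓝 (toWeakSpace 𝕜 E x))

/-- Every subsequence of `u` has a sub-subsequence that converges weakly in `E`. -/
def WeakSubseqCompact (𝕜 : Type*) {E : Type*} [RCLike 𝕜] [AddCommGroup E] [Module 𝕜 E]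
    [TopologicalSpace E] (u : ℕ → E) : Prop :=
  ∀ k : ℕ → ℕ, StrictMono k → ∃ j : ℕ → ℕ, StrictMono j ∧
    ∃ x : E, WeakTendsto 𝕜 (fun i => u (k (j i))) x

/-- `f` is a local solution on `[0,l)` of `f' = Z̄ f`, `f(0) = h`, where `Z̄` is the closure of `Z`:
`f(s) ∈ D(Z̄)` and `f'(s) = Z̄ f(s)` for all `s ∈ [0,l)`, and `f(0) = h`.
Only the values of `f` on `[0,l)` matter. As the variable ranges over `ℝ≥0`, the derivative at `0`
is the right derivative. -/
def IsLocalSolution [TopologicalSpace E] [IsTopologicalAddGroup E] [ContinuousSMul 𝕜 E]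
    (Z : E →ₗ.[𝕜] E) (l : ℝ≥0) (h : E) (f : ℝ≥0 → E) : Prop :=
  f 0 = h ∧ ∀ s : ℝ≥0, s < l → ∃ hs : f s ∈ Z.closure.domain,
    Tendsto (fun v : ℝ≥0 => ((((v : ℝ) - (s : ℝ) : ℝ) : 𝕜))⁻¹ • (f v - f s)) (𝓝[≠] s)
      (𝓝 (Z.closure ⟨f s, hs⟩))

/-- Condition (a): for each `s ∈ [0,l)`, every subsequence of `F(t/n)^[ns/t] h` has a weakly
convergent sub-subsequence. -/
def CondA [TopologicalSpace E] (F : ℝ≥0 → E →L[𝕜] E) (t l : ℝ≥0) (h : E) : Prop :=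
  ∀ s : ℝ≥0, s < l →
    WeakSubseqCompact 𝕜 (fun n : ℕ => (F (t / n) ^ ⌊(n : ℝ≥0) * s / t⌋₊) h)

/-- Condition (b): for each `s ∈ [0,l)` there are `g n ∈ D(Z̄)` such that `F(t/n)^[ns/t] h - g n`
converges weakly to `0` and every subsequence of `Z̄ (g n)` has a weakly convergent
sub-subsequence. -/
def CondB [TopologicalSpace E] [IsTopologicalAddGroup E] [ContinuousSMul 𝕜 E]
    (Z : E →ₗ.[𝕜] E) (F : ℝ≥0 → E →L[𝕜] E) (t l : ℝ≥0) (h : E) : Prop :=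
  ∀ s : ℝ≥0, s < l → ∃ g : ℕ → Z.closure.domain,
    WeakTendsto 𝕜 (fun n : ℕ => (F (t / n) ^ ⌊(n : ℝ≥0) * s / t⌋₊) h - (g n : E)) 0 ∧
    WeakSubseqCompact 𝕜 (fun n : ℕ => Z.closure (g n))

end General

section Uniform

variable {𝕜 E : Type*} [RCLike 𝕜] [AddCommGroup E] [Module 𝕜 E] [UniformSpace E]
  [IsUniformAddGroup E] [ContinuousSMul 𝕜 E]

/-- A set `A ⊆ E^*` is *-dense: every `φ ∈ E^*` is the limit of a sequence in `A`, pointwise on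
the completion of `E` (functionals being extended to the completion by continuity). -/
def StarDense (A : Set (StrongDual 𝕜 E)) : Prop :=
  ∀ φ : StrongDual 𝕜 E, ∃ ψ : ℕ → StrongDual 𝕜 E, (∀ k, ψ k ∈ A) ∧
    ∀ x : UniformSpace.Completion E,
      Tendsto (fun k => UniformSpace.Completion.extension (ψ k : E → 𝕜) x) atTop
        (𝓝 (UniformSpace.Completion.extension (φ : E → 𝕜) x))

/-- The class `𝓔_E`: `F(0) = I` and each family `B_s^F` is equicontinuous. -/
def ClassE (F : ℝ≥0 → E →L[𝕜] E) : Prop :=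
  F 0 = ContinuousLinearMap.id 𝕜 E ∧
    ∀ s : ℝ≥0, Equicontinuous (fun (G : chernoffFamily F s) (x : E) => (G : E →L[𝕜] E) x)

/-- The class `𝓕_E`: `F ∈ 𝓔_E` and `D(F'_mef(0))` is dense. -/
def ClassF (F : ℝ≥0 → E →L[𝕜] E) : Prop :=
  ClassE F ∧ Dense (mefDerivDomain F)

/-- The class `𝓩_E`: densely defined operators `Z` for which there is `F ∈ 𝓕_E` with
`Z x ∈ F'_mef(0) x` for all `x ∈ D(Z)`. -/
def ClassZ (Z : E →ₗ.[𝕜] E) : Prop :=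
  Dense (Z.domain : Set E) ∧ ∃ F : ℝ≥0 → E →L[𝕜] E, ClassF F ∧
    ∀ x : Z.domain, ((x : E), Z x) ∈ mefDerivGraph F

end Uniform

end ChernoffLCS

end

/-! A local Chernoff theorem in locally convex spaces.

Write `r` for a small step size and `k r` for the elapsed time. Everything rests on one Duhamel-type
estimate, `eventually_pow_sub_self_sub_sum_le`: if `(x, z)` lies in the closure of the graph of the
effective derivative of `F` at `0`, then `F(r)^k x - x` is `r ∑_{j<k} F(r)^j z` up to an error that
tends to `0` with `r`, uniformly for `k r` bounded. Since `F(r)^j z` varies slowly with `j r`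
(density of the domain and equicontinuity), the sum may be replaced by `k r F(r)^m z` for a single
intermediate `m` (`exists_pow_sub_pow_sub_smul_le`). Taking `x = 0` shows that the closure of the
graph is single-valued, so that the effective derivative exists and its restrictions are closable.

*A local solution is the limit of the Chernoff products.* Fix an end time `s` and a continuous
seminorm `p`. The limit `L v` of `p (F(r)^[(s-v)/r] f(v) - F(r)^[s/r] h)` along an ultrafilter is
continuous in `v ∈ [0,s]`, and the estimate above shows that its right derivative is `0`, so
`L s = L 0 = 0` (`tendsto_pow_floor_of_isLocalSolution`). No continuity of `f'` is needed.
Conditions (a) and (b) and the final convergence claim follow immediately.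

*Conditions (a) and (b) produce a local solution.* A diagonal argument and equicontinuity in time
give one subsequence along which `F(r)^[s/r] h` converges weakly to some `f(s)`, for every `s < l`.
Condition (b) and the weak closedness of the graph of `Z̄` give `f(s) ∈ D(Z̄)`. The difference
quotients of `F(r)^[s/r] h` in `s` are close in seminorm to `g(s) = F(r)^[s/r] Z h`, hence those of
`f` are Cauchy, and converge in the completion of the space. For `φ` in the domain of the derivative
of the adjoint family, with derivative `ψ`, one has `φ(g(s)) - ψ(F(r)^[s/r] h) → 0` and
`φ(Z̄ x) = ψ(x)`, which identifies the limit with `Z̄ f(s)` as far as such `φ` can see. *-density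
on the completion then identifies it altogether (`StarDense.tendsto_of_seminorm_cauchy`). -/

namespace ChernoffLCS

/-! ### Equicontinuity and approximation of powers -/

section Approximation

open Finset in
theorem pow_sub_self_eq_sum {𝕜 E : Type*} [RCLike 𝕜] [AddCommGroup E] [Module 𝕜 E]
    [TopologicalSpace E] {F : ℝ≥0 → E →L[𝕜] E} (h0 : F 0 = ContinuousLinearMap.id 𝕜 E)
    {r : ℝ≥0} (hr : r ≠ 0) (k : ℕ) (x : E) :
    (F r ^ k) x - x = ((r : ℝ) : 𝕜) • ∑ j ∈ range k, (F r ^ j) (diffQuot F r x) := by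
  have hr' : ((r : ℝ) : 𝕜) ≠ 0 := by simpa using hr
  induction k with
  | zero => simp
  | succ k ih =>
    rw [sum_range_succ, smul_add, ← ih, ← map_smul, diffQuot, smul_inv_smul₀ hr', h0, pow_succ]
    simp

theorem seminorm_sum_le {𝕜 E ι : Type*} [RCLike 𝕜] [AddCommGroup E]
    [Module 𝕜 E] (p : Seminorm 𝕜 E) (s : Finset ι) (u : ι → E) {c : ℝ}
    (h : ∀ i ∈ s, p (u i) ≤ c) : p (∑ i ∈ s, u i) ≤ s.card * c := by
  classical
  induction s using Finset.induction_on with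
  | empty => simp
  | insert a s ha ih =>
    rw [Finset.sum_insert ha, Finset.card_insert_of_notMem ha]
    have h1 := map_add_le_add p (u a) (∑ i ∈ s, u i)
    have h2 := h a (Finset.mem_insert_self a s)
    have h3 := ih fun i hi => h i (Finset.mem_insert_of_mem hi)
    push_cast
    linarith

theorem seminorm_smul_nnreal {𝕜 E : Type*} [RCLike 𝕜] [AddCommGroup E] [Module 𝕜 E]
    (p : Seminorm 𝕜 E) (r : ℝ≥0) (x : E) :
    p (((r : ℝ) : 𝕜) • x) = r * p x := by
  rw [map_smul_eq_mul]
  simp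

theorem pow_apply_sub_pow_apply {𝕜 E : Type*} [RCLike 𝕜] [AddCommGroup E] [Module 𝕜 E]
    [UniformSpace E] [IsUniformAddGroup E] {F : ℝ≥0 → E →L[𝕜] E} {i j : ℕ} (hij : i ≤ j)
    (r : ℝ≥0) (z : E) :
    (F r ^ j) z - (F r ^ i) z = (F r ^ i) ((F r ^ (j - i)) z - z) := by
  conv_lhs => rw [← Nat.add_sub_cancel' hij, pow_add]
  simp

variable {𝕜 E : Type*} [RCLike 𝕜] [AddCommGroup E] [Module 𝕜 E] [UniformSpace E]
  [IsUniformAddGroup E] [ContinuousSMul 𝕜 E] {F : ℝ≥0 → E →L[𝕜] E}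

/-- Equicontinuity in terms of seminorms. The bound covers `k = 0` as well, which the Chernoff
family excludes, because `q` dominates `p`. -/
theorem ClassE.exists_seminorm_bound [PolynormableSpace 𝕜 E] (hF : ClassE F) {p : Seminorm 𝕜 E}
    (hp : Continuous p) (S : ℝ≥0) :
    ∃ q : Seminorm 𝕜 E, Continuous q ∧ p ≤ q ∧
      ∀ (r : ℝ≥0) (k : ℕ), k * r ≤ S → ∀ x, p ((F r ^ k) x) ≤ q x := by
  have h := hF.2 S
  have h1 := ((PolynormableSpace.withSeminorms 𝕜 E).equicontinuous_TFAE
    (fun G : chernoffFamily F S => ((G : E →L[𝕜] E) : E →ₗ[𝕜] E))).out 1 3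
  obtain ⟨q, hq, hle⟩ := h1.1 h ⟨p, hp⟩
  refine ⟨p ⊔ q, ?_, le_sup_left, fun r k hk x => ?_⟩
  · have : ⇑(p ⊔ q) = ⇑p ⊔ ⇑q := Seminorm.coe_sup p q
    rw [this]
    exact hp.sup hq
  · rcases Nat.eq_zero_or_pos k with rfl | hk0
    · simp
    · refine le_trans ?_ (le_sup_right (a := p) (b := q) x)
      exact hle ⟨F r ^ k, 1, k, r, one_pos, hk0, by simpa using hk, by simp⟩ x

open Finset in
/-- Duhamel estimate for the closure of the graph of the effective derivative: `F(r)^k x - x` is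
`r ∑_{j<k} F(r)^j z` up to an error that vanishes as `r → 0`, uniformly for `k r ≤ S`. -/
theorem eventually_pow_sub_self_sub_sum_le [PolynormableSpace 𝕜 E] (hF : ClassE F) {x z : E}
    (hxz : (x, z) ∈ closure (mefDerivGraph F : Set (E × E))) {p : Seminorm 𝕜 E}
    (hp : Continuous p) (S : ℝ≥0) {ε : ℝ} (hε : 0 < ε) :
    ∀ᶠ r in 𝓝[>] (0 : ℝ≥0), ∀ k : ℕ, k * r ≤ S →
      p ((F r ^ k) x - x - ((r : ℝ) : 𝕜) • ∑ j ∈ range k, (F r ^ j) z) ≤ ε := by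
  obtain ⟨q, hq, hpq, hb⟩ := hF.exists_seminorm_bound hp S
  set δ : ℝ := ε / (2 + S) with hδ
  have hδ0 : 0 < δ := by positivity
  have hopen : IsOpen {w : E × E | q (x - w.1) < δ ∧ q (z - w.2) < δ} :=
    (isOpen_lt (hq.comp (by fun_prop : Continuous fun w : E × E => x - w.1))
      continuous_const).inter
      (isOpen_lt (hq.comp (by fun_prop : Continuous fun w : E × E => z - w.2)) continuous_const)
  obtain ⟨⟨a, b⟩, ⟨ha, hb'⟩, u, hu, hu'⟩ :=
    mem_closure_iff.1 hxz _ hopen (by simp [hδ0])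
  have e1 : ∀ᶠ r in 𝓝[>] (0 : ℝ≥0), q (x - u r) < δ :=
    (((hq.comp (continuous_sub_left x)).tendsto a).comp hu).eventually_lt_const ha
  have e2 : ∀ᶠ r in 𝓝[>] (0 : ℝ≥0), q (z - diffQuot F r (u r)) < δ :=
    (((hq.comp (continuous_sub_left z)).tendsto b).comp hu').eventually_lt_const hb'
  filter_upwards [e1, e2, self_mem_nhdsWithin] with r h1 h2 hr k hk
  have hr0 : r ≠ 0 := (Set.mem_Ioi.1 hr).ne'
  have key : (F r ^ k) x - x - ((r : ℝ) : 𝕜) • ∑ j ∈ range k, (F r ^ j) z =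
      (F r ^ k) (x - u r) - (x - u r)
        - ((r : ℝ) : 𝕜) • ∑ j ∈ range k, (F r ^ j) (z - diffQuot F r (u r)) := by
    have := pow_sub_self_eq_sum hF.1 hr0 k (u r)
    simp only [map_sub, sum_sub_distrib, smul_sub, ← this]
    abel
  rw [key]
  have b1 : p ((F r ^ k) (x - u r)) ≤ δ := (hb r k hk _).trans h1.le
  have b2 : p (x - u r) ≤ δ := (hpq _).trans h1.le
  have b3 : p (∑ j ∈ range k, (F r ^ j) (z - diffQuot F r (u r))) ≤ k * δ := by
    have := seminorm_sum_le p (range k) (fun j => (F r ^ j) (z - diffQuot F r (u r))) (c := δ) ?_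
    · simpa using this
    · intro j hj
      refine (hb r j (le_trans ?_ hk) _).trans h2.le
      have : j ≤ k := (mem_range.1 hj).le
      gcongr
  have b4 : p (((r : ℝ) : 𝕜) • ∑ j ∈ range k, (F r ^ j) (z - diffQuot F r (u r))) ≤ S * δ := by
    rw [seminorm_smul_nnreal]
    have hk' : (k : ℝ) * r ≤ S := by exact_mod_cast hk
    calc (r : ℝ) * _ ≤ r * (k * δ) := by gcongr
      _ = (k * r) * δ := by ring
      _ ≤ S * δ := by gcongr
  have c1 := map_sub_le_add p ((F r ^ k) (x - u r) - (x - u r))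
    (((r : ℝ) : 𝕜) • ∑ j ∈ range k, (F r ^ j) (z - diffQuot F r (u r)))
  have c2 := map_sub_le_add p ((F r ^ k) (x - u r)) (x - u r)
  have : δ * (2 + S) = ε := by rw [hδ]; field_simp
  linarith

/-- Strong continuity of the powers at time `0`, uniformly in small step sizes. It uses that the
domain of the effective derivative is dense. -/
theorem exists_pow_sub_self_le [PolynormableSpace 𝕜 E] (hF : ClassF F) (z : E) {p : Seminorm 𝕜 E}
    (hp : Continuous p) {ε : ℝ} (hε : 0 < ε) :
    ∃ η : ℝ≥0, 0 < η ∧ ∀ᶠ r in 𝓝[>] (0 : ℝ≥0), ∀ k : ℕ, k * r ≤ η →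
      p ((F r ^ k) z - z) ≤ ε := by
  obtain ⟨q, hq, hpq, hb⟩ := hF.1.exists_seminorm_bound hp 1
  have hopen : IsOpen {w : E | q (z - w) < ε / 4} :=
    isOpen_lt (by fun_prop) continuous_const
  obtain ⟨a, ha, b, hab⟩ := hF.2.inter_open_nonempty _ hopen ⟨z, by simp [hε]⟩
  have ha' : q (z - a) < ε / 4 := ha
  have hqb : 0 ≤ q b := apply_nonneg q b
  -- Chosen so that `η * q b ≤ ε / 4`, which bounds the sum in the Duhamel estimate.
  set η : ℝ≥0 := min 1 (Real.toNNReal (ε / 4 / (1 + q b))) with hη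
  have hη0 : 0 < η := lt_min one_pos (Real.toNNReal_pos.2 (by positivity))
  have hηq : (η : ℝ) * q b ≤ ε / 4 := by
    have h1 : (η : ℝ) ≤ ε / 4 / (1 + q b) := by
      have : η ≤ Real.toNNReal (ε / 4 / (1 + q b)) := min_le_right _ _
      rwa [← NNReal.coe_le_coe, Real.coe_toNNReal _ (by positivity)] at this
    calc (η : ℝ) * q b ≤ ε / 4 / (1 + q b) * (1 + q b) := by gcongr; linarith
      _ = ε / 4 := by field_simp
  refine ⟨η, hη0, ?_⟩
  filter_upwards [eventually_pow_sub_self_sub_sum_le hF.1 (subset_closure hab) hp 1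
    (ε := ε / 4) (by positivity)] with r hr k hk
  have hk1 : (k : ℝ≥0) * r ≤ 1 := hk.trans (min_le_left _ _)
  have b0 := hr k hk1
  have b1 : p ((F r ^ k) (z - a)) ≤ ε / 4 := (hb r k hk1 _).trans ha'.le
  have b2 : p (z - a) ≤ ε / 4 := (hpq _).trans ha'.le
  have b3 : p (((r : ℝ) : 𝕜) • ∑ j ∈ Finset.range k, (F r ^ j) b) ≤ ε / 4 := by
    have := seminorm_sum_le p (Finset.range k) (fun j => (F r ^ j) b) (c := q b) ?_
    · rw [seminorm_smul_nnreal]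
      rw [Finset.card_range] at this
      have hk' : (k : ℝ) * r ≤ η := by exact_mod_cast hk
      calc (r : ℝ) * _ ≤ r * (k * q b) := by gcongr
        _ = (k * r) * q b := by ring
        _ ≤ η * q b := by gcongr
        _ ≤ ε / 4 := hηq
    · intro j hj
      refine hb r j (le_trans ?_ hk1) _
      have : j ≤ k := (Finset.mem_range.1 hj).le
      gcongr
  have key : (F r ^ k) z - z = ((F r ^ k) (z - a) - (z - a)) +
      (((F r ^ k) a - a - ((r : ℝ) : 𝕜) • ∑ j ∈ Finset.range k, (F r ^ j) b) +
        ((r : ℝ) : 𝕜) • ∑ j ∈ Finset.range k, (F r ^ j) b) := by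
    rw [map_sub]; abel
  rw [key]
  have c1 := map_add_le_add p ((F r ^ k) (z - a) - (z - a))
    (((F r ^ k) a - a - ((r : ℝ) : 𝕜) • ∑ j ∈ Finset.range k, (F r ^ j) b) +
        ((r : ℝ) : 𝕜) • ∑ j ∈ Finset.range k, (F r ^ j) b)
  have c2 := map_add_le_add p ((F r ^ k) a - a - ((r : ℝ) : 𝕜) • ∑ j ∈ Finset.range k, (F r ^ j) b)
        (((r : ℝ) : 𝕜) • ∑ j ∈ Finset.range k, (F r ^ j) b)
  have c3 := map_sub_le_add p ((F r ^ k) (z - a)) (z - a)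
  linarith

theorem exists_pow_sub_pow_le [PolynormableSpace 𝕜 E] (hF : ClassF F) (z : E) {p : Seminorm 𝕜 E}
    (hp : Continuous p) (S : ℝ≥0) {ε : ℝ} (hε : 0 < ε) :
    ∃ η : ℝ≥0, 0 < η ∧ ∀ᶠ r in 𝓝[>] (0 : ℝ≥0), ∀ i j : ℕ, i ≤ j → j * r ≤ S →
      (j - i : ℕ) * r ≤ η → p ((F r ^ j) z - (F r ^ i) z) ≤ ε := by
  obtain ⟨q, hq, hpq, hb⟩ := hF.1.exists_seminorm_bound hp S
  obtain ⟨η, hη, h⟩ := exists_pow_sub_self_le hF z hq hε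
  refine ⟨η, hη, ?_⟩
  filter_upwards [h] with r hr i j hij hjS hd
  rw [pow_apply_sub_pow_apply hij]
  refine (hb r i (le_trans ?_ hjS) _).trans (hr _ hd)
  gcongr

open Finset in
/-- The increment of `F(r)^· x` over the steps `i, …, j` is the elapsed time times `F(r)^m z`, for
any intermediate `m`. The relative error `ε` only restricts the elapsed time; the absolute error
`ε'` vanishes as `r → 0` and does not affect `η`. -/
theorem exists_pow_sub_pow_sub_smul_le [PolynormableSpace 𝕜 E] (hF : ClassF F) {x z : E}
    (hxz : (x, z) ∈ closure (mefDerivGraph F : Set (E × E))) {p : Seminorm 𝕜 E}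
    (hp : Continuous p) (S : ℝ≥0) {ε : ℝ} (hε : 0 < ε) :
    ∃ η : ℝ≥0, 0 < η ∧ ∀ ε' > 0, ∀ᶠ r in 𝓝[>] (0 : ℝ≥0), ∀ i j m : ℕ, i ≤ m → m ≤ j →
      j * r ≤ S → (j - i : ℕ) * r ≤ η →
      p ((F r ^ j) x - (F r ^ i) x - ((((j - i : ℕ) * r : ℝ≥0) : ℝ) : 𝕜) • (F r ^ m) z) ≤
        ((j - i : ℕ) * r : ℝ≥0) * ε + ε' := by
  obtain ⟨q, hq, hpq, hb⟩ := hF.1.exists_seminorm_bound hp S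
  obtain ⟨η, hη, h⟩ := exists_pow_sub_pow_le hF z hp S hε
  refine ⟨η, hη, fun ε' hε' => ?_⟩
  filter_upwards [h, eventually_pow_sub_self_sub_sum_le hF.1 hxz hq S hε']
    with r hr hd i j m him hmj hjS hη'
  have mono : ∀ {a b : ℕ}, a ≤ b → (a : ℝ≥0) * r ≤ b * r := fun hab => by gcongr
  set k := j - i with hk
  have hji : j = i + k := by omega
  have key : (F r ^ j) x - (F r ^ i) x - ((((k : ℕ) * r : ℝ≥0) : ℝ) : 𝕜) • (F r ^ m) z =
      (F r ^ i) ((F r ^ k) x - x - ((r : ℝ) : 𝕜) • ∑ l ∈ range k, (F r ^ l) z) +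
      ((r : ℝ) : 𝕜) • ∑ l ∈ range k, ((F r ^ (i + l)) z - (F r ^ m) z) := by
    rw [map_sub, ← pow_apply_sub_pow_apply (by omega : i ≤ j), map_smul, map_sum,
      sum_sub_distrib, smul_sub]
    have hadd : ∀ l, (F r ^ (i + l)) z = (F r ^ i) ((F r ^ l) z) := fun l => by
      rw [pow_add]; rfl
    simp only [hadd, sum_const, card_range, ← Nat.cast_smul_eq_nsmul 𝕜, smul_smul]
    rw [NNReal.coe_mul, NNReal.coe_natCast, RCLike.ofReal_mul, RCLike.ofReal_natCast,
      mul_comm (k : 𝕜)]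
    abel
  rw [key]
  have b1 := (hb r i ((mono (by omega)).trans hjS) _).trans
    (hd k ((mono (by omega)).trans hjS))
  have b2 := seminorm_sum_le p (range k) (fun l => (F r ^ (i + l)) z - (F r ^ m) z) (c := ε) ?_
  · have c1 := map_add_le_add p
      ((F r ^ i) ((F r ^ k) x - x - ((r : ℝ) : 𝕜) • ∑ l ∈ range k, (F r ^ l) z))
      (((r : ℝ) : 𝕜) • ∑ l ∈ range k, ((F r ^ (i + l)) z - (F r ^ m) z))
    rw [seminorm_smul_nnreal] at c1
    rw [card_range] at b2
    have : (r : ℝ) * p (∑ l ∈ range k, ((F r ^ (i + l)) z - (F r ^ m) z)) ≤ r * (k * ε) := by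
      gcongr
    rw [NNReal.coe_mul, NNReal.coe_natCast]
    linarith
  · intro l hl
    have hl' := mem_range.1 hl
    -- `m` is intermediate, so either order of `m` and `i + l` may occur.
    rcases le_total m (i + l) with hml | hml
    · exact hr _ _ hml ((mono (by omega)).trans hjS) ((mono (by omega)).trans hη')
    · rw [map_sub_rev]
      exact hr _ _ hml ((mono (by omega)).trans hjS) ((mono (by omega)).trans hη')

end Approximation

/-! ### Number of steps up to a given time -/

section Steps

theorem tendsto_div_natCast_nhdsGT_zero {t : ℝ≥0} (ht : 0 < t) :
    Tendsto (fun n : ℕ => t / n) atTop (𝓝[>] 0) := by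
  refine tendsto_nhdsWithin_iff.2 ⟨?_, ?_⟩
  · rw [← NNReal.tendsto_coe]
    simpa using tendsto_const_div_atTop_nhds_zero_nat (t : ℝ)
  · filter_upwards [eventually_gt_atTop 0] with n hn
    exact div_pos ht (Nat.cast_pos.2 hn)

theorem floor_mul_div_le {t : ℝ≥0} (ht : 0 < t) (s : ℝ≥0) (n : ℕ) :
    (⌊(n : ℝ≥0) * s / t⌋₊ : ℝ≥0) * (t / n) ≤ s := by
  rcases Nat.eq_zero_or_pos n with rfl | hn
  · simp
  · have hn' : (0 : ℝ≥0) < n := Nat.cast_pos.2 hn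
    calc (⌊(n : ℝ≥0) * s / t⌋₊ : ℝ≥0) * (t / n) ≤ (n * s / t) * (t / n) := by
          gcongr; exact Nat.floor_le zero_le
      _ = s := by field_simp

theorem tendsto_floor_mul_div {t : ℝ≥0} (ht : 0 < t) (s : ℝ≥0) :
    Tendsto (fun n : ℕ => (⌊(n : ℝ≥0) * s / t⌋₊ : ℝ≥0) * (t / n)) atTop (𝓝 s) := by
  have h0 : Tendsto (fun n : ℕ => t / n) atTop (𝓝 0) :=
    (tendsto_div_natCast_nhdsGT_zero ht).mono_right nhdsWithin_le_nhds
  have h1 : Tendsto (fun n : ℕ => s - t / n) atTop (𝓝 s) := by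
    simpa using tendsto_const_nhds.sub h0
  refine tendsto_of_tendsto_of_tendsto_of_le_of_le' h1 tendsto_const_nhds ?_
    (Eventually.of_forall fun n => floor_mul_div_le ht s n)
  filter_upwards [eventually_gt_atTop 0] with n hn
  have hn' : (0 : ℝ≥0) < n := Nat.cast_pos.2 hn
  rw [tsub_le_iff_right]
  calc s = (n * s / t) * (t / n) := by field_simp
    _ ≤ (⌊(n : ℝ≥0) * s / t⌋₊ + 1) * (t / n) := by
        gcongr; exact (Nat.lt_floor_add_one _).le
    _ = _ := by ring

theorem floor_mul_div_mono (t : ℝ≥0) (n : ℕ) {s s' : ℝ≥0} (h : s ≤ s') :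
    ⌊(n : ℝ≥0) * s / t⌋₊ ≤ ⌊(n : ℝ≥0) * s' / t⌋₊ := by
  gcongr

theorem tendsto_floor_sub_floor_mul_div {t : ℝ≥0} (ht : 0 < t) (s s' : ℝ≥0) :
    Tendsto (fun n : ℕ => ((⌊(n : ℝ≥0) * s' / t⌋₊ - ⌊(n : ℝ≥0) * s / t⌋₊ : ℕ) : ℝ≥0) * (t / n))
      atTop (𝓝 (s' - s)) := by
  refine ((tendsto_floor_mul_div ht s').sub (tendsto_floor_mul_div ht s)).congr fun n => ?_
  rw [← tsub_mul, Nat.cast_tsub]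

end Steps

/-! ### Single-valuedness and closability -/

section Closability

variable {𝕜 E : Type*} [RCLike 𝕜] [AddCommGroup E] [Module 𝕜 E] [UniformSpace E]
  [IsUniformAddGroup E] [ContinuousSMul 𝕜 E] [PolynormableSpace 𝕜 E] {F : ℝ≥0 → E →L[𝕜] E}

/-- The closure of the graph of the effective derivative contains no vertical vectors. -/
theorem ClassF.eq_zero_of_mem_closure [T2Space E] (hF : ClassF F) {y : E}
    (hy : ((0 : E), y) ∈ closure (mefDerivGraph F : Set (E × E))) : y = 0 := by
  by_contra hne
  obtain ⟨⟨p, hp⟩, hpy⟩ := (PolynormableSpace.withSeminorms 𝕜 E).separating_of_T1 y hne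
  have hpy0 : 0 < p y := lt_of_le_of_ne (apply_nonneg p y) (Ne.symm hpy)
  obtain ⟨η, hη, h⟩ := exists_pow_sub_pow_sub_smul_le hF hy hp 1 (ε := p y / 4) (by positivity)
  -- With step size `θ / n`, exactly `n` steps take time `θ`.
  set θ : ℝ≥0 := min η 1
  have hθ : 0 < θ := lt_min hη one_pos
  obtain ⟨n, hn, hn0⟩ := (((tendsto_div_natCast_nhdsGT_zero hθ).eventually
    (h (θ * p y / 4) (by positivity))).and (eventually_gt_atTop 0)).exists
  have hn' : (n : ℝ≥0) * (θ / n) = θ := by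
    have : (n : ℝ≥0) ≠ 0 := by positivity
    field_simp
  have := hn 0 n 0 le_rfl (Nat.zero_le _) (by rw [hn']; exact min_le_right _ _)
    (by rw [Nat.sub_zero, hn']; exact min_le_left _ _)
  rw [Nat.sub_zero, hn'] at this
  simp only [map_zero, sub_zero, zero_sub, map_neg_eq_map, pow_zero] at this
  rw [seminorm_smul_nnreal] at this
  change (θ : ℝ) * p y ≤ _ at this
  have : 0 < (θ : ℝ) * p y := by positivity
  linarith

theorem ClassF.effDerivExists [T2Space E] (hF : ClassF F) : EffDerivExists F := by
  intro x y z hy hz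
  have h : ((0 : E), y - z) ∈ mefDerivGraph F := by
    simpa using (mefDerivGraph F).sub_mem hy hz
  exact sub_eq_zero.1 (hF.eq_zero_of_mem_closure (subset_closure h))

theorem ClassF.graph_le_mefDerivGraph [T2Space E] (hF : ClassF F) {Z : E →ₗ.[𝕜] E}
    (hZ : Z ≤ effDeriv F) : Z.graph ≤ mefDerivGraph F := by
  have h := LinearPMap.le_graph_of_le hZ
  rwa [effDeriv, Submodule.toLinearPMap_graph_eq] at h
  rintro ⟨x, y⟩ hx rfl
  exact hF.eq_zero_of_mem_closure (subset_closure hx)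

theorem ClassF.isClosable [T2Space E] (hF : ClassF F) {Z : E →ₗ.[𝕜] E}
    (hZ : Z ≤ effDeriv F) : Z.IsClosable := by
  refine ⟨Z.graph.topologicalClosure.toLinearPMap, ?_⟩
  rw [Submodule.toLinearPMap_graph_eq]
  rintro ⟨x, y⟩ hx rfl
  exact hF.eq_zero_of_mem_closure (closure_mono (hF.graph_le_mefDerivGraph hZ) hx)

theorem ClassF.mem_closure_mefDerivGraph [T2Space E] (hF : ClassF F) {Z : E →ₗ.[𝕜] E}
    (hZ : Z ≤ effDeriv F) (x : Z.closure.domain) :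
    ((x : E), Z.closure x) ∈ closure (mefDerivGraph F : Set (E × E)) := by
  have h : ((x : E), Z.closure x) ∈ Z.closure.graph := Z.closure.mem_graph x
  rw [← (hF.isClosable hZ).graph_closure_eq_closure_graph] at h
  exact closure_mono (hF.graph_le_mefDerivGraph hZ) h

end Closability

/-! ### Real functions with zero right slope -/

section Convergence

/-- A function on `[0,s]` that is continuous from the left and has vanishing right derivative takes
the same value at both ends. The left continuity is phrased one-sidedly because continuity from the
right follows from the slope condition. -/
theorem constant_of_right_slope {L : ℝ≥0 → ℝ} {s : ℝ≥0}
    (hc : ∀ v ≤ s, ∀ ε > 0, ∃ η : ℝ≥0, 0 < η ∧ ∀ w, w ≤ v → v ≤ w + η → |L v - L w| ≤ ε)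
    (hd : ∀ v < s, ∀ ε > 0, ∃ η : ℝ≥0, 0 < η ∧ ∀ w ≤ s, v ≤ w → w ≤ v + η →
      |L w - L v| ≤ ε * (w - v : ℝ)) : L s = L 0 := by
  have key := constant_of_has_deriv_right_zero (f := fun x : ℝ => L x.toNNReal) (a := 0) (b := s)
    ?_ ?_ s ⟨s.2, le_rfl⟩
  · simpa using key
  · intro x hx
    lift x to ℝ≥0 using hx.1
    have hxs : x ≤ s := by exact_mod_cast hx.2
    rw [Metric.continuousWithinAt_iff]
    intro ε hε
    obtain ⟨η, hη, h⟩ := hc x hxs (ε / 2) (by positivity)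
    have h2 : ∃ η' : ℝ≥0, 0 < η' ∧ ∀ w ≤ s, x ≤ w → w ≤ x + η' → |L w - L x| ≤ ε / 2 := by
      rcases hxs.lt_or_eq with hlt | rfl
      · obtain ⟨η', hη', h'⟩ := hd x hlt (ε / 2) (by positivity)
        refine ⟨min η' 1, lt_min hη' one_pos, fun w hw hxw hwx => ?_⟩
        refine (h' w hw hxw (hwx.trans (by gcongr; exact min_le_left _ _))).trans ?_
        have : (w : ℝ) ≤ x + 1 := by
          exact_mod_cast hwx.trans (by gcongr; exact min_le_right _ _)
        nlinarith
      · refine ⟨1, one_pos, fun w hw hxw _ => ?_⟩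
        rw [le_antisymm hw hxw]
        simp only [sub_self, abs_zero]
        positivity
    obtain ⟨η', hη', h'⟩ := h2
    refine ⟨min η η', by positivity, fun {w} hw hwx => ?_⟩
    lift w to ℝ≥0 using hw.1
    have hws : w ≤ s := by exact_mod_cast hw.2
    simp only [Real.toNNReal_coe, Real.dist_eq] at hwx ⊢
    obtain ⟨a1, a2⟩ := abs_lt.1 hwx
    have m1 := min_le_left (η : ℝ) η'
    have m2 := min_le_right (η : ℝ) η'
    rcases le_total w x with hle | hle
    · rw [abs_sub_comm]
      refine (h w hle ?_).trans_lt (by linarith)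
      rw [← NNReal.coe_le_coe]; push_cast; linarith
    · refine (h' w hws hle ?_).trans_lt (by linarith)
      rw [← NNReal.coe_le_coe]; push_cast; linarith
  · intro x hx
    lift x to ℝ≥0 using hx.1
    have hxs : x < s := by exact_mod_cast hx.2
    rw [hasDerivWithinAt_iff_isLittleO, Asymptotics.isLittleO_iff]
    intro ε hε
    obtain ⟨η, hη, h⟩ := hd x hxs ε hε
    have hlt : (x : ℝ) < min (s : ℝ) (x + η) := by
      refine lt_min (by exact_mod_cast hxs) ?_
      have : (0 : ℝ) < η := by exact_mod_cast hη
      linarith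
    filter_upwards [Ico_mem_nhdsGE hlt] with w hw
    lift w to ℝ≥0 using x.2.trans hw.1
    have hxw : x ≤ w := by exact_mod_cast hw.1
    have hws : w ≤ s := by exact_mod_cast (hw.2.trans_le (min_le_left _ _)).le
    have hwx : w ≤ x + η := by exact_mod_cast (hw.2.trans_le (min_le_right _ _)).le
    simp only [Real.toNNReal_coe, smul_zero, sub_zero, Real.norm_eq_abs]
    rw [abs_of_nonneg (a := (w : ℝ) - x) (sub_nonneg.2 hw.1)]
    exact h w hws hxw hwx

end Convergence

/-! ### Convergence of the Chernoff products to a local solution -/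

section LocalSolution

theorem tendsto_nhds_of_forall_seminorm {𝕜 E : Type*} [RCLike 𝕜] [AddCommGroup E]
    [Module 𝕜 E] [TopologicalSpace E] [PolynormableSpace 𝕜 E] {ι : Type*} {u : ι → E}
    {φ : Filter ι} {x : E}
    (h : ∀ p : Seminorm 𝕜 E, Continuous p → Tendsto (fun i => p (u i - x)) φ (𝓝 0)) :
    Tendsto u φ (𝓝 x) := by
  refine ((PolynormableSpace.withSeminorms 𝕜 E).tendsto_nhds _ _).2 ?_
  rintro ⟨p, hp⟩ ε hε
  exact (h p hp).eventually_lt_const hε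

variable {𝕜 E : Type*} [RCLike 𝕜] [AddCommGroup E] [Module 𝕜 E] [UniformSpace E]
  [IsUniformAddGroup E]

theorem exists_sub_sub_smul_le_of_tendsto_slope {f : ℝ≥0 → E} {v : ℝ≥0} {z : E}
    (hf : Tendsto (fun w : ℝ≥0 => ((((w : ℝ) - (v : ℝ) : ℝ) : 𝕜))⁻¹ • (f w - f v)) (𝓝[≠] v) (𝓝 z))
    {q : Seminorm 𝕜 E} (hq : Continuous q) {ε : ℝ} (hε : 0 < ε) :
    ∃ η : ℝ≥0, 0 < η ∧ ∀ w : ℝ≥0, |(w : ℝ) - v| ≤ η →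
      q (f w - f v - (((w : ℝ) - v : ℝ) : 𝕜) • z) ≤ ε * |(w : ℝ) - v| := by
  have h1 : ∀ᶠ w : ℝ≥0 in 𝓝[≠] v, q (((((w : ℝ) - (v : ℝ) : ℝ) : 𝕜))⁻¹ • (f w - f v) - z) < ε := by
    refine (((hq.comp (continuous_sub_right z)).tendsto z).comp hf).eventually_lt_const ?_
    simpa using hε
  rw [eventually_nhdsWithin_iff, Metric.eventually_nhds_iff] at h1
  obtain ⟨δ, hδ, h⟩ := h1
  refine ⟨(δ / 2).toNNReal, Real.toNNReal_pos.2 (by positivity), fun w hw => ?_⟩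
  rw [Real.coe_toNNReal _ (by positivity)] at hw
  rcases eq_or_ne w v with rfl | hne
  · simp
  · have hne' : (((w : ℝ) - v : ℝ) : 𝕜) ≠ 0 := by
      rw [Ne, RCLike.ofReal_eq_zero, sub_eq_zero]
      exact_mod_cast hne
    have h2 := h (y := w) (by rw [NNReal.dist_eq]; linarith) hne
    have h3 : f w - f v - (((w : ℝ) - v : ℝ) : 𝕜) • z = (((w : ℝ) - v : ℝ) : 𝕜) •
        (((((w : ℝ) - (v : ℝ) : ℝ) : 𝕜))⁻¹ • (f w - f v) - z) := by
      rw [smul_sub, smul_inv_smul₀ hne']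
    rw [h3, map_smul_eq_mul, RCLike.norm_ofReal, mul_comm]
    gcongr

theorem exists_sub_le_of_tendsto_slope {f : ℝ≥0 → E} {v : ℝ≥0} {z : E}
    (hf : Tendsto (fun w : ℝ≥0 => ((((w : ℝ) - (v : ℝ) : ℝ) : 𝕜))⁻¹ • (f w - f v)) (𝓝[≠] v) (𝓝 z))
    {q : Seminorm 𝕜 E} (hq : Continuous q) {ε : ℝ} (hε : 0 < ε) :
    ∃ η : ℝ≥0, 0 < η ∧ ∀ w : ℝ≥0, |(w : ℝ) - v| ≤ η → q (f w - f v) ≤ ε := by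
  obtain ⟨η, hη, h⟩ := exists_sub_sub_smul_le_of_tendsto_slope hf hq one_pos
  have hqz : 0 ≤ q z := apply_nonneg q z
  refine ⟨min η (ε / (1 + q z)).toNNReal, lt_min hη (Real.toNNReal_pos.2 (by positivity)),
    fun w hw => ?_⟩
  have hw' : |(w : ℝ) - v| ≤ min (η : ℝ) (ε / (1 + q z)) := by
    rwa [NNReal.coe_min, Real.coe_toNNReal _ (by positivity)] at hw
  have h1 := h w (hw'.trans (min_le_left _ _))
  have h2 : |(w : ℝ) - v| * (1 + q z) ≤ ε := by
    rw [← le_div_iff₀ (by positivity)]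
    exact hw'.trans (min_le_right _ _)
  have h3 := map_add_le_add q (f w - f v - (((w : ℝ) - v : ℝ) : 𝕜) • z)
    ((((w : ℝ) - v : ℝ) : 𝕜) • z)
  rw [sub_add_cancel, map_smul_eq_mul, RCLike.norm_ofReal] at h3
  linarith

variable [ContinuousSMul 𝕜 E] {F : ℝ≥0 → E →L[𝕜] E}

/-- A local solution is the limit of the Chernoff products, for every step scale `t > 0`. -/
theorem tendsto_pow_floor_of_isLocalSolution [PolynormableSpace 𝕜 E] [T2Space E] (hF : ClassF F)
    {Z : E →ₗ.[𝕜] E} (hZ : Z ≤ effDeriv F) {l : ℝ≥0} {h : E} {f : ℝ≥0 → E}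
    (hf : IsLocalSolution Z l h f) {t : ℝ≥0} (ht : 0 < t) {s : ℝ≥0} (hs : s < l) :
    Tendsto (fun n : ℕ => (F (t / n) ^ ⌊(n : ℝ≥0) * s / t⌋₊) h) atTop (𝓝 (f s)) := by
  refine tendsto_nhds_of_forall_seminorm (𝕜 := 𝕜) fun p hp => ?_
  obtain ⟨q, hq, hpq, hb⟩ := hF.1.exists_seminorm_bound hp s
  obtain ⟨q', hq', hqq', hb'⟩ := hF.1.exists_seminorm_bound hq s
  rw [tendsto_iff_ultrafilter]
  intro U hU
  have hr : Tendsto (fun n : ℕ => t / n) U (𝓝[>] 0) :=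
    (tendsto_div_natCast_nhdsGT_zero ht).mono_left hU
  -- `m v n` is the number of steps up to time `v`.
  set m : ℝ≥0 → ℕ → ℕ := fun v n => ⌊(n : ℝ≥0) * v / t⌋₊ with hm
  have hms : ∀ v n, (m v n : ℝ≥0) * (t / n) ≤ v := fun v n => floor_mul_div_le ht v n
  have hmono : ∀ {v w : ℝ≥0}, v ≤ w → ∀ n, m v n ≤ m w n := fun hvw n => floor_mul_div_mono t n hvw
  have hle : ∀ {a b : ℕ} (n : ℕ), a ≤ b → (a : ℝ≥0) * (t / n) ≤ b * (t / n) := fun n hab => by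
    gcongr
  have hdiff : ∀ v w : ℝ≥0, Tendsto (fun n => ((m w n - m v n : ℕ) : ℝ≥0) * (t / n)) U
      (𝓝 (w - v)) := fun v w => (tendsto_floor_sub_floor_mul_div ht v w).mono_left hU
  -- The solution is followed up to time `v`, and the Chernoff product is applied from `v` to `s`.
  -- For `v > s` the truncated subtraction gives `0` steps; only boundedness matters there.
  set a : ℝ≥0 → ℕ → ℝ := fun v n =>
    p ((F (t / n) ^ (m s n - m v n)) (f v) - (F (t / n) ^ m s n) h) with ha
  have hlim : ∀ v, ∃ L, Tendsto (a v) U (𝓝 L) := by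
    intro v
    have hbd : ∀ n, a v n ∈ Set.Icc 0 (q (f v) + q h) := fun n => by
      refine ⟨apply_nonneg p _, (map_sub_le_add p _ _).trans (add_le_add ?_ ?_)⟩
      · exact hb _ _ ((hle n (Nat.sub_le _ _)).trans (hms s n)) _
      · exact hb _ _ (hms s n) _
    obtain ⟨L, -, hL⟩ := isCompact_Icc.ultrafilter_le_nhds (U.map (a v))
      (by
        rw [le_principal_iff]
        exact mem_map.2 (univ_mem' hbd))
    exact ⟨L, hL⟩
  choose L hL using hlim
  have hstep : ∀ {v w : ℝ≥0}, v ≤ w → w ≤ s → ∀ n,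
      |a w n - a v n| ≤ q (f w - (F (t / n) ^ (m w n - m v n)) (f v)) := by
    intro v w hvw hws n
    have e : (F (t / n) ^ (m s n - m v n)) (f v) =
        (F (t / n) ^ (m s n - m w n)) ((F (t / n) ^ (m w n - m v n)) (f v)) := by
      have : m s n - m v n = (m s n - m w n) + (m w n - m v n) := by
        have := hmono hvw n
        have := hmono hws n
        omega
      rw [this, pow_add]; rfl
    refine (abs_sub_map_le_sub p _ _).trans ?_
    rw [sub_sub_sub_cancel_right, e, ← map_sub]
    exact hb _ _ ((hle n (Nat.sub_le _ _)).trans (hms s n)) _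
  have hstepL : ∀ {v w : ℝ≥0}, v ≤ w → w ≤ s → ∀ {b : ℕ → ℝ} {c : ℝ},
      (∀ᶠ n : ℕ in U, q (f w - (F (t / n) ^ (m w n - m v n)) (f v)) ≤ b n) → Tendsto b U (𝓝 c) →
      |L w - L v| ≤ c := by
    intro v w hvw hws b c hbn hbc
    refine le_of_tendsto_of_tendsto ((hL w).sub (hL v)).abs hbc ?_
    filter_upwards [hbn] with n hn using (hstep hvw hws n).trans hn
  have hconst : L s = L 0 := by
    refine constant_of_right_slope (s := s) ?_ ?_
    · intro v hvs ε hε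
      obtain ⟨hv, hvd⟩ := hf.2 v (hvs.trans_lt hs)
      obtain ⟨η₁, hη₁, h₁⟩ := exists_pow_sub_self_le hF (f v) hq (ε := ε / 2) (by positivity)
      obtain ⟨η₂, hη₂, h₂⟩ := exists_sub_le_of_tendsto_slope hvd hq' (ε := ε / 2) (by positivity)
      refine ⟨min (η₁ / 2) η₂, lt_min (by positivity) hη₂, fun w hwv hvw => ?_⟩
      have hvw' : v - w < η₁ := by
        refine (tsub_le_iff_left.2 hvw).trans_lt ((min_le_left _ _).trans_lt ?_)
        exact NNReal.half_lt_self hη₁.ne'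
      refine hstepL hwv hvs (b := fun _ => ε) ?_ tendsto_const_nhds
      filter_upwards [hr.eventually h₁, (hdiff w v).eventually_lt_const hvw'] with n hn hn'
      have c1 := hn _ hn'.le
      have c2 := hb' (t / n) (m v n - m w n) ((hle n (Nat.sub_le _ _)).trans
        ((hms v n).trans hvs)) (f w - f v)
      have c3 : q' (f w - f v) ≤ ε / 2 := by
        refine h₂ w ?_
        have : (v : ℝ) ≤ w + η₂ := by
          exact_mod_cast hvw.trans (by gcongr; exact min_le_right _ _)
        have : (w : ℝ) ≤ v := by exact_mod_cast hwv
        rw [abs_le]; constructor <;> linarith [η₂.2]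
      have e : f v - (F (t / n) ^ (m v n - m w n)) (f w) =
          -((F (t / n) ^ (m v n - m w n)) (f v) - f v) -
            (F (t / n) ^ (m v n - m w n)) (f w - f v) := by
        rw [map_sub]; abel
      rw [e]
      refine (map_sub_le_add q _ _).trans ?_
      rw [map_neg_eq_map]
      linarith
    · intro v hvs ε hε
      obtain ⟨hv, hvd⟩ := hf.2 v (hvs.trans hs)
      set z := Z.closure ⟨f v, hv⟩
      obtain ⟨η₁, hη₁, h₁⟩ := exists_pow_sub_pow_sub_smul_le hF
        (hF.mem_closure_mefDerivGraph hZ ⟨f v, hv⟩) hq s (ε := ε / 2) (by positivity)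
      obtain ⟨η₂, hη₂, h₂⟩ := exists_sub_sub_smul_le_of_tendsto_slope hvd hq
        (ε := ε / 2) (by positivity)
      refine ⟨min (η₁ / 2) η₂, lt_min (by positivity) hη₂, fun w hws hvw hwv => ?_⟩
      have hvw' : w - v < η₁ := by
        refine (tsub_le_iff_left.2 hwv).trans_lt ((min_le_left _ _).trans_lt ?_)
        exact NNReal.half_lt_self hη₁.ne'
      have hvwR : (v : ℝ) ≤ w := by exact_mod_cast hvw
      have habs : |(w : ℝ) - v| = w - v := abs_of_nonneg (sub_nonneg.2 hvwR)
      have c1 : q (f w - f v - (((w : ℝ) - v : ℝ) : 𝕜) • z) ≤ ε / 2 * (w - v) := by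
        have := h₂ w ?_
        · rwa [habs] at this
        · rw [habs]
          have : (w : ℝ) ≤ v + η₂ := by
            exact_mod_cast hwv.trans (by gcongr; exact min_le_right _ _)
          linarith
      refine le_of_forall_pos_le_add fun ε' hε' => ?_
      set k : ℕ → ℝ≥0 := fun n => ((m w n - m v n : ℕ) : ℝ≥0) * (t / n) with hk
      have hkR : Tendsto (fun n => (k n : ℝ)) U (𝓝 ((w : ℝ) - v)) := by
        have := (NNReal.tendsto_coe.2 (hdiff v w))
        rwa [NNReal.coe_sub hvw] at this
      refine hstepL hvw hws (b := fun n => ε / 2 * (w - v) + ((k n : ℝ) * (ε / 2) + ε') +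
        |(k n : ℝ) - (w - v)| * q z) ?_ ?_
      · filter_upwards [hr.eventually (h₁ ε' hε'), (hdiff v w).eventually_lt_const hvw']
          with n hn hn'
        have c2 := hn 0 (m w n - m v n) 0 le_rfl (Nat.zero_le _)
          ((hle n (Nat.sub_le _ _)).trans ((hms w n).trans hws)) (by simpa using hn'.le)
        rw [Nat.sub_zero] at c2
        change q (_ - _ - (((k n : ℝ≥0) : ℝ) : 𝕜) • _) ≤ (k n : ℝ) * (ε / 2) + ε' at c2
        have e : f w - (F (t / n) ^ (m w n - m v n)) (f v) =
            (f w - f v - (((w : ℝ) - v : ℝ) : 𝕜) • z) -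
            ((F (t / n) ^ (m w n - m v n)) (f v) - (F (t / n) ^ 0) (f v) -
              ((k n : ℝ) : 𝕜) • (F (t / n) ^ 0) z) - (((k n : ℝ) - (w - v) : ℝ) : 𝕜) • z := by
          simp only [pow_zero, one_apply_eq_self, RCLike.ofReal_sub, sub_smul]
          abel
        rw [e]
        refine (map_sub_le_add q _ _).trans (add_le_add ((map_sub_le_add q _ _).trans
          (add_le_add c1 c2)) ?_)
        rw [map_smul_eq_mul, RCLike.norm_ofReal]
      · have : Tendsto (fun n => ε / 2 * (w - v) + ((k n : ℝ) * (ε / 2) + ε') +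
            |(k n : ℝ) - (w - v)| * q z) U (𝓝 (ε / 2 * (w - v) + (((w : ℝ) - v) * (ε / 2) + ε') +
            |((w : ℝ) - v) - (w - v)| * q z)) :=
          (tendsto_const_nhds.add ((hkR.mul_const _).add_const _)).add
            ((hkR.sub_const _).abs.mul_const _)
        convert this using 2
        simp
        ring
  have hL0 : L 0 = 0 := by
    refine tendsto_nhds_unique (hL 0) (tendsto_const_nhds.congr fun n => ?_)
    simp [ha, hm, hf.1]
  have := hL s
  rw [hconst, hL0] at this
  refine this.congr fun n => ?_
  simp only [ha, Nat.sub_self, pow_zero, one_apply_eq_self]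
  exact map_sub_rev p _ _

end LocalSolution

/-! ### Weak convergence and diagonal subsequences -/

section Weak

theorem WeakTendsto.apply {𝕜 E : Type*} [RCLike 𝕜] [AddCommGroup E] [Module 𝕜 E]
    [TopologicalSpace E] {u : ℕ → E} {x : E} (h : WeakTendsto 𝕜 u x) (φ : StrongDual 𝕜 E) :
    Tendsto (fun n => φ (u n)) atTop (𝓝 (φ x)) :=
  ((WeakBilin.eval_continuous (topDualPairing 𝕜 E).flip φ).tendsto _).comp h

theorem weakTendsto_of_tendsto {𝕜 E : Type*} [RCLike 𝕜] [AddCommGroup E] [Module 𝕜 E]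
    [TopologicalSpace E] {u : ℕ → E} {x : E} (h : Tendsto u atTop (𝓝 x)) :
    WeakTendsto 𝕜 u x :=
  ((toWeakSpaceCLM 𝕜 E).continuous.tendsto x).comp h

/-- Diagonal extraction: if for each `i` every subsequence of `u i` has a convergent subsequence,
then one subsequence serves all `i`. -/
theorem exists_strictMono_forall_tendsto {X : Type*} [TopologicalSpace X] (u : ℕ → ℕ → X)
    (h : ∀ i, ∀ k : ℕ → ℕ, StrictMono k → ∃ j : ℕ → ℕ, StrictMono j ∧
      ∃ x, Tendsto (fun n => u i (k (j n))) atTop (𝓝 x)) :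
    ∃ k : ℕ → ℕ, StrictMono k ∧ ∀ i, ∃ x, Tendsto (fun n => u i (k n)) atTop (𝓝 x) := by
  choose! J hJ hconv using h
  let K : ℕ → ℕ → ℕ := fun n => Nat.rec id (fun i k => k ∘ J i k) n
  have hK0 : K 0 = id := rfl
  have hKs : ∀ i, K (i + 1) = K i ∘ J i (K i) := fun i => rfl
  have hKm : ∀ i, StrictMono (K i) := fun i => by
    induction i with
    | zero => exact strictMono_id
    | succ i ih => rw [hKs]; exact ih.comp (hJ i _ ih)
  have hfac : ∀ i n, i ≤ n → ∃ θ : ℕ → ℕ, StrictMono θ ∧ K n = K i ∘ θ := by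
    intro i n hin
    induction n, hin using Nat.le_induction with
    | base => exact ⟨id, strictMono_id, rfl⟩
    | succ n hin ih =>
      obtain ⟨θ, hθ, e⟩ := ih
      exact ⟨θ ∘ J n (K n), hθ.comp (hJ n _ (hKm n)), by rw [hKs, e]; rfl⟩
  refine ⟨fun n => K n n, strictMono_nat_of_lt_succ fun n => ?_, fun i => ?_⟩
  · rw [hKs]
    exact hKm n (n.lt_succ_self.trans_le ((hJ n _ (hKm n)).le_apply))
  · obtain ⟨x, hx⟩ := hconv i (K i) (hKm i)
    refine ⟨x, ?_⟩
    choose! θ hθ hθe using fun n => hfac (i + 1) n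
    -- From index `i + 1` on, the diagonal is a subsequence of the one on which `u i` converges.
    have hlim : Tendsto (fun n => θ n n) atTop atTop := by
      refine tendsto_atTop_mono' _ ?_ tendsto_id
      filter_upwards [eventually_ge_atTop (i + 1)] with n hn using (hθ n hn).le_apply
    refine (hx.comp hlim).congr' ?_
    filter_upwards [eventually_ge_atTop (i + 1)] with n hn
    rw [hθe n hn, hKs]
    rfl

variable {𝕜 E ι : Type*} [RCLike 𝕜] [AddCommGroup E] [Module 𝕜 E] [TopologicalSpace E]
  [IsTopologicalAddGroup E] [ContinuousSMul 𝕜 E]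

/-- Closed convex sets are weakly closed. -/
theorem mem_of_forall_dual_tendsto [Module ℝ E] [IsScalarTower ℝ 𝕜 E] [LocallyConvexSpace ℝ E]
    {C : Set E} (hC : Convex ℝ C) (hC' : IsClosed C) {l : Filter ι} [l.NeBot] {u : ι → E} {x : E}
    (hu : ∀ᶠ i in l, u i ∈ C)
    (hx : ∀ φ : StrongDual 𝕜 E, Tendsto (fun i => φ (u i)) l (𝓝 (φ x))) : x ∈ C := by
  by_contra hxC
  obtain ⟨φ, c, h1, h2⟩ := RCLike.geometric_hahn_banach_closed_point (𝕜 := 𝕜) hC hC' hxC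
  have h3 : Tendsto (fun i => RCLike.re (φ (u i))) l (𝓝 (RCLike.re (φ x))) :=
    (RCLike.continuous_re.tendsto _).comp (hx φ)
  exact h2.not_ge (le_of_tendsto h3 (hu.mono fun i hi => (h1 _ hi).le))

variable [PolynormableSpace 𝕜 E]

/-- Continuous seminorms are weakly lower semicontinuous. -/
theorem seminorm_le_of_forall_dual_tendsto {l : Filter ι} [l.NeBot] {u : ι → E} {x : E}
    (hx : ∀ φ : StrongDual 𝕜 E, Tendsto (fun i => φ (u i)) l (𝓝 (φ x))) {p : Seminorm 𝕜 E}
    (hp : Continuous p) {c : ℝ} (hu : ∀ᶠ i in l, p (u i) ≤ c) : p x ≤ c := by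
  let : Module ℝ E := .restrictScalars ℝ 𝕜 E
  let : IsScalarTower ℝ 𝕜 E := .restrictScalars _ _ _
  have : LocallyConvexSpace ℝ E := (PolynormableSpace.withSeminorms 𝕜 E).toLocallyConvexSpace
  have hC : Convex ℝ (p.closedBall 0 c) := p.convex_closedBall 0 c
  have hC' : IsClosed (p.closedBall 0 c) := by
    simp only [Seminorm.closedBall, sub_zero]
    exact isClosed_le hp continuous_const
  have := mem_of_forall_dual_tendsto hC hC' (l := l) (u := u) (x := x)
    (by simpa [Seminorm.mem_closedBall] using hu) hx
  simpa [Seminorm.mem_closedBall] using this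

theorem eq_of_forall_dual_eq [T2Space E] {x y : E}
    (hxy : ∀ φ : StrongDual 𝕜 E, φ x = φ y) : x = y := by
  by_contra hne
  obtain ⟨⟨p, hp⟩, hpy⟩ := (PolynormableSpace.withSeminorms 𝕜 E).separating_of_T1 (x - y)
    (sub_ne_zero.2 hne)
  refine hpy (le_antisymm (seminorm_le_of_forall_dual_tendsto (l := pure ())
    (u := fun _ => (0 : E)) (fun φ => ?_) hp (c := 0) (by simp)) (apply_nonneg p _))
  simp [hxy φ]

/-- A closed linear relation is closed under weak convergence in each component. -/
theorem mem_of_forall_dual_tendsto_prod {M : Submodule 𝕜 (E × E)}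
    (hM : IsClosed (M : Set (E × E))) {l : Filter ι} [l.NeBot] {a b : ι → E} {x y : E}
    (hab : ∀ i, (a i, b i) ∈ M)
    (ha : ∀ φ : StrongDual 𝕜 E, Tendsto (fun i => φ (a i)) l (𝓝 (φ x)))
    (hb : ∀ φ : StrongDual 𝕜 E, Tendsto (fun i => φ (b i)) l (𝓝 (φ y))) : (x, y) ∈ M := by
  let : Module ℝ E := .restrictScalars ℝ 𝕜 E
  let : IsScalarTower ℝ 𝕜 E := .restrictScalars _ _ _
  have : LocallyConvexSpace ℝ E := (PolynormableSpace.withSeminorms 𝕜 E).toLocallyConvexSpace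
  refine mem_of_forall_dual_tendsto (𝕜 := 𝕜) (C := (M : Set (E × E)))
    (M.restrictScalars ℝ).convex hM (l := l) (u := fun i => (a i, b i))
    (Eventually.of_forall hab) fun Φ => ?_
  have e : ∀ v w : E, Φ (v, w) = Φ.comp (ContinuousLinearMap.inl 𝕜 E E) v +
      Φ.comp (ContinuousLinearMap.inr 𝕜 E E) w := fun v w => by simp [← map_add]
  simp only [e]
  exact (ha _).add (hb _)

end Weak

/-! ### Identification of a limit in the completion -/

section Completion

variable {𝕜 E ι : Type*} [RCLike 𝕜] [AddCommGroup E] [Module 𝕜 E] [UniformSpace E]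
  [IsUniformAddGroup E] [ContinuousSMul 𝕜 E] [PolynormableSpace 𝕜 E]

/-- A Cauchy family converges to `y` as soon as a *-dense set of functionals says so. The limit is
first taken in the completion, where *-density shows that no functional distinguishes it from `y`;
this makes `y` the weak limit, and a Cauchy family converges to its weak limit because closed
seminorm balls are weakly closed. -/
theorem StarDense.tendsto_of_seminorm_cauchy {A : Set (StrongDual 𝕜 E)} (hA : StarDense A)
    {l : Filter ι} [l.NeBot] {d : ι → E} {y : E}
    (hd : ∀ p : Seminorm 𝕜 E, Continuous p → ∀ ε > 0, ∃ s ∈ l, ∀ v ∈ s, ∀ w ∈ s,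
      p (d v - d w) ≤ ε)
    (hy : ∀ φ ∈ A, Tendsto (fun i => φ (d i)) l (𝓝 (φ y))) : Tendsto d l (𝓝 y) := by
  have hc : Cauchy (map d l) := by
    refine cauchy_map_iff.2 ⟨inferInstance, ?_⟩
    rw [uniformity_eq_comap_nhds_zero, tendsto_comap_iff]
    refine tendsto_nhds_of_forall_seminorm (𝕜 := 𝕜) fun p hp => ?_
    rw [Metric.tendsto_nhds]
    intro ε hε
    obtain ⟨s, hs, h⟩ := hd p hp (ε / 2) (by positivity)
    filter_upwards [prod_mem_prod hs hs] with x hx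
    have := h _ hx.2 _ hx.1
    rw [Real.dist_eq, sub_zero, sub_zero, abs_of_nonneg (apply_nonneg p _)]
    exact this.trans_lt (by linarith)
  obtain ⟨y', hy'⟩ := CompleteSpace.complete
    (hc.map (UniformSpace.Completion.uniformContinuous_coe E))
  have hext : ∀ φ : StrongDual 𝕜 E, Tendsto (fun i => φ (d i)) l
      (𝓝 (UniformSpace.Completion.extension (φ : E → 𝕜) y')) := fun φ => by
    have h1 : Tendsto (fun i => ((d i : E) : UniformSpace.Completion E)) l (𝓝 y') := hy'
    refine ((UniformSpace.Completion.continuous_extension.tendsto y').comp h1).congr fun i => ?_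
    exact UniformSpace.Completion.extension_coe φ.uniformContinuous _
  have hall : ∀ φ : StrongDual 𝕜 E, Tendsto (fun i => φ (d i)) l (𝓝 (φ y)) := fun φ => by
    obtain ⟨ψ, hψ, hlim⟩ := hA φ
    have h1 := hlim y'
    have h2 := hlim (y : UniformSpace.Completion E)
    have h3 : ∀ k, UniformSpace.Completion.extension (ψ k : E → 𝕜) y' =
        UniformSpace.Completion.extension (ψ k : E → 𝕜) (y : UniformSpace.Completion E) :=
      fun k => by
        rw [UniformSpace.Completion.extension_coe (ψ k).uniformContinuous]
        exact tendsto_nhds_unique (hext _) (hy _ (hψ k))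
    have h4 := tendsto_nhds_unique (h1.congr h3) h2
    rw [UniformSpace.Completion.extension_coe φ.uniformContinuous] at h4
    rw [← h4]
    exact hext φ
  refine tendsto_nhds_of_forall_seminorm (𝕜 := 𝕜) fun p hp => ?_
  rw [Metric.tendsto_nhds]
  intro ε hε
  obtain ⟨s, hs, h⟩ := hd p hp (ε / 2) (by positivity)
  filter_upwards [hs] with v hv
  have : p (d v - y) ≤ ε / 2 := by
    refine seminorm_le_of_forall_dual_tendsto (l := l) (u := fun w => d v - d w) (fun φ => ?_) hp ?_
    · simp only [map_sub]
      exact tendsto_const_nhds.sub (hall φ)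
    · filter_upwards [hs] with w hw using h v hv w hw
  rw [Real.dist_eq, sub_zero, abs_of_nonneg (apply_nonneg p _)]
  exact this.trans_lt (by linarith)

end Completion

/-! ### The derivative of the adjoint family -/

section Adjoint

theorem diffQuot_pow_apply {𝕜 E : Type*} [RCLike 𝕜] [AddCommGroup E] [Module 𝕜 E]
    [UniformSpace E] [IsUniformAddGroup E] {F : ℝ≥0 → E →L[𝕜] E}
    (h0 : F 0 = ContinuousLinearMap.id 𝕜 E) (r : ℝ≥0) (m : ℕ) (x : E) :
    diffQuot F r ((F r ^ m) x) = (F r ^ m) (diffQuot F r x) := by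
  have : F r ((F r ^ m) x) = (F r ^ m) (F r x) := by
    change (F r * F r ^ m) x = (F r ^ m * F r) x
    rw [(Commute.self_pow (F r) m).eq]
  simp only [diffQuot, h0, map_smul, map_sub, ContinuousLinearMap.id_apply, this]

variable {𝕜 E : Type*} [RCLike 𝕜] [AddCommGroup E] [Module 𝕜 E] [UniformSpace E]
  [IsUniformAddGroup E] [ContinuousSMul 𝕜 E] [PolynormableSpace 𝕜 E] {F : ℝ≥0 → E →L[𝕜] E}

/-- The difference quotients of the adjoint family converge uniformly on bounded sets, in particular
along a bounded sequence of vectors. -/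
theorem tendsto_apply_diffQuot_sub {φ ψ : StrongDual 𝕜 E}
    (hφ : Tendsto (fun r : ℝ≥0 => diffQuot (adjointFun F) r φ) (𝓝[>] 0) (𝓝 ψ))
    {r : ℕ → ℝ≥0} (hr : Tendsto r atTop (𝓝[>] 0)) {w : ℕ → E}
    (hw : ∀ p : Seminorm 𝕜 E, Continuous p → ∃ C, ∀ n, p (w n) ≤ C) :
    Tendsto (fun n => φ (diffQuot F (r n) (w n)) - ψ (w n)) atTop (𝓝 0) := by
  have hb : Bornology.IsVonNBounded 𝕜 (Set.range w) := by
    refine ((PolynormableSpace.withSeminorms 𝕜 E).isVonNBounded_iff_seminorm_bounded).2 ?_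
    rintro ⟨p, hp⟩
    obtain ⟨C, hC⟩ := hw p hp
    refine ⟨|C| + 1, by positivity, ?_⟩
    rintro _ ⟨n, rfl⟩
    exact (hC n).trans_lt ((le_abs_self C).trans_lt (by linarith))
  have h1 : Tendsto (fun n => diffQuot (adjointFun F) (r n) φ - ψ) atTop (𝓝 0) := by
    have := (hφ.comp hr).sub_const ψ
    rwa [sub_self] at this
  rw [Metric.tendsto_nhds]
  intro ε hε
  have h2 := h1.eventually
    (ContinuousLinearMap.eventually_nhds_zero_mapsTo hb (Metric.ball_mem_nhds (0 : 𝕜) hε))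
  filter_upwards [h2] with n hn
  have := hn (Set.mem_range_self n)
  have e : φ (diffQuot F (r n) (w n)) - ψ (w n) =
      (diffQuot (adjointFun F) (r n) φ - ψ) (w n) := by
    simp [diffQuot, adjointFun]
  rwa [e]

/-- Duality between the derivative of the adjoint family and the effective derivative. The family
`x_r` of the effective derivative is restricted to a sequence of step sizes, since only a convergent
sequence, not a convergent net, is bounded. -/
theorem apply_eq_of_mem_closure_mefDerivGraph {φ ψ : StrongDual 𝕜 E}
    (hφ : Tendsto (fun r : ℝ≥0 => diffQuot (adjointFun F) r φ) (𝓝[>] 0) (𝓝 ψ)) {x z : E}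
    (hxz : (x, z) ∈ closure (mefDerivGraph F : Set (E × E))) : φ z = ψ x := by
  have hcl : IsClosed {w : E × E | φ w.2 = ψ w.1} :=
    isClosed_eq (by fun_prop) (by fun_prop)
  refine closure_minimal ?_ hcl hxz
  rintro ⟨a, b⟩ ⟨u, hu, hu'⟩
  have hr := tendsto_div_natCast_nhdsGT_zero one_pos
  have h1 := tendsto_apply_diffQuot_sub hφ hr (w := fun n => u (1 / n)) fun p hp => by
    obtain ⟨C, hC⟩ := ((hp.tendsto a).comp (hu.comp hr)).bddAbove_range
    exact ⟨C, fun n => hC (Set.mem_range_self n)⟩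
  have h2 := ((φ.continuous.tendsto b).comp (hu'.comp hr)).sub
    ((ψ.continuous.tendsto a).comp (hu.comp hr))
  exact sub_eq_zero.1 (tendsto_nhds_unique h2 h1)

/-- Asymptotically, `φ` sees `F(r)^m z` as the derivative `ψ` of the adjoint family at `φ` sees
`F(r)^m x`. -/
theorem ClassE.tendsto_apply_pow_sub (hF : ClassE F) {φ ψ : StrongDual 𝕜 E}
    (hφ : Tendsto (fun r : ℝ≥0 => diffQuot (adjointFun F) r φ) (𝓝[>] 0) (𝓝 ψ)) {x z : E}
    (hxz : (x, z) ∈ mefDerivGraph F) {r : ℕ → ℝ≥0} (hr : Tendsto r atTop (𝓝[>] 0)) {m : ℕ → ℕ}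
    {S : ℝ≥0} (hm : ∀ n, m n * r n ≤ S) :
    Tendsto (fun n => φ ((F (r n) ^ m n) z) - ψ ((F (r n) ^ m n) x)) atTop (𝓝 0) := by
  obtain ⟨u, hu, hu'⟩ := hxz
  have hur := hu.comp hr
  have hur' := hu'.comp hr
  have h1 := tendsto_apply_diffQuot_sub hφ hr (w := fun n => (F (r n) ^ m n) (u (r n)))
    fun p hp => by
      obtain ⟨q, hq, -, hb⟩ := hF.exists_seminorm_bound hp S
      obtain ⟨C, hC⟩ := ((hq.tendsto x).comp hur).bddAbove_range
      exact ⟨C, fun n => (hb _ _ (hm n) _).trans (hC (Set.mem_range_self n))⟩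
  have hsmall : ∀ (χ : StrongDual 𝕜 E) {w : ℕ → E} {y : E}, Tendsto w atTop (𝓝 y) →
      Tendsto (fun n => χ ((F (r n) ^ m n) (w n - y))) atTop (𝓝 0) := fun χ w y hw => by
    obtain ⟨q, hq, -, hb⟩ := hF.exists_seminorm_bound (p := χ.toLinearMap.toSeminorm)
      χ.continuous.norm S
    have h2 : Tendsto (fun n => q (w n - y)) atTop (𝓝 0) := by
      have := (hq.tendsto 0).comp (tendsto_sub_nhds_zero_iff.2 hw)
      rwa [map_zero] at this
    exact squeeze_zero_norm (fun n => hb _ _ (hm n) _) h2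
  have h3 := (h1.sub (hsmall φ hur')).add (hsmall ψ hur)
  rw [sub_zero, add_zero] at h3
  refine h3.congr fun n => ?_
  simp only [diffQuot_pow_apply hF.1, map_sub, Function.comp_apply]
  abel

end Adjoint

/-! ### Existence of a local solution and the equivalence -/

section Existence

variable {𝕜 E : Type*} [RCLike 𝕜] [AddCommGroup E] [Module 𝕜 E] [UniformSpace E]
  [IsUniformAddGroup E] [ContinuousSMul 𝕜 E] [PolynormableSpace 𝕜 E] {F : ℝ≥0 → E →L[𝕜] E}

theorem ClassF.exists_floor_pow_sub_le (hF : ClassF F) {t : ℝ≥0} (ht : 0 < t) (x : E)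
    {p : Seminorm 𝕜 E} (hp : Continuous p) (S : ℝ≥0) {ε : ℝ} (hε : 0 < ε) :
    ∃ η : ℝ≥0, 0 < η ∧ ∀ s s' : ℝ≥0, s ≤ s' → s' ≤ S → s' - s < η → ∀ᶠ n : ℕ in atTop,
      p ((F (t / n) ^ ⌊(n : ℝ≥0) * s' / t⌋₊) x - (F (t / n) ^ ⌊(n : ℝ≥0) * s / t⌋₊) x) ≤ ε := by
  obtain ⟨η, hη, h⟩ := exists_pow_sub_pow_le hF x hp S hε
  refine ⟨η, hη, fun s s' hss hs' hlt => ?_⟩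
  filter_upwards [(tendsto_div_natCast_nhdsGT_zero ht).eventually h,
    (tendsto_floor_sub_floor_mul_div ht s s').eventually_lt_const hlt] with n hn hn'
  exact hn _ _ (floor_mul_div_mono t n hss) ((floor_mul_div_le ht s' n).trans hs') hn'.le

/-- The difference quotients in time of the Chernoff products of `x` are close to the Chernoff
products of `z`, on either side of the time `s`. -/
theorem ClassF.exists_slope_floor_pow_sub_le (hF : ClassF F) {t : ℝ≥0} (ht : 0 < t) {x z : E}
    (hxz : (x, z) ∈ closure (mefDerivGraph F : Set (E × E)))
    {p : Seminorm 𝕜 E} (hp : Continuous p) (S : ℝ≥0) {ε : ℝ} (hε : 0 < ε) :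
    ∃ η : ℝ≥0, 0 < η ∧ ∀ s s' : ℝ≥0, s ≤ S → s' ≤ S → s' ≠ s → |(s' : ℝ) - s| < η →
      ∀ᶠ n : ℕ in atTop,
        p ((((s' : ℝ) - s : ℝ) : 𝕜)⁻¹ • ((F (t / n) ^ ⌊(n : ℝ≥0) * s' / t⌋₊) x -
          (F (t / n) ^ ⌊(n : ℝ≥0) * s / t⌋₊) x) - (F (t / n) ^ ⌊(n : ℝ≥0) * s / t⌋₊) z) ≤ ε := by
  obtain ⟨q, hq, hpq, hb⟩ := hF.1.exists_seminorm_bound hp S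
  obtain ⟨η, hη, h⟩ := exists_pow_sub_pow_sub_smul_le hF hxz hp S (ε := ε / 4) (by positivity)
  -- Increments over `[a, b]` compared with an intermediate time `c`; below, `c` is the left or the
  -- right endpoint, according to the side from which `s` is approached.
  have main : ∀ a b c : ℝ≥0, a < b → b ≤ S → (b : ℝ) - a < η → a ≤ c → c ≤ b →
      ∀ᶠ n : ℕ in atTop, p ((((b : ℝ) - a : ℝ) : 𝕜)⁻¹ • ((F (t / n) ^ ⌊(n : ℝ≥0) * b / t⌋₊) x -
          (F (t / n) ^ ⌊(n : ℝ≥0) * a / t⌋₊) x) - (F (t / n) ^ ⌊(n : ℝ≥0) * c / t⌋₊) z) ≤ ε := by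
    intro a b c hab hbS hlt hac hcb
    have habR : 0 < (b : ℝ) - a := sub_pos.2 (by exact_mod_cast hab)
    have hlt' : b - a < η := by
      rw [← NNReal.coe_lt_coe, NNReal.coe_sub hab.le]; exact hlt
    set k : ℕ → ℝ≥0 := fun n =>
      ((⌊(n : ℝ≥0) * b / t⌋₊ - ⌊(n : ℝ≥0) * a / t⌋₊ : ℕ) : ℝ≥0) * (t / n) with hk
    have hklim : Tendsto k atTop (𝓝 (b - a)) := tendsto_floor_sub_floor_mul_div ht a b
    have hkR : Tendsto (fun n => (k n : ℝ)) atTop (𝓝 ((b : ℝ) - a)) := by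
      have := NNReal.tendsto_coe.2 hklim
      rwa [NNReal.coe_sub hab.le] at this
    have hbound : Tendsto (fun n => (k n : ℝ) * (ε / 4) + ((b : ℝ) - a) * (ε / 4) +
        |(k n : ℝ) - (b - a)| * q z) atTop
        (𝓝 (((b : ℝ) - a) * (ε / 4) + ((b : ℝ) - a) * (ε / 4) +
          |((b : ℝ) - a) - (b - a)| * q z)) :=
      ((hkR.mul_const _).add_const _).add ((hkR.sub_const _).abs.mul_const _)
    have hlt2 : ((b : ℝ) - a) * (ε / 4) + ((b : ℝ) - a) * (ε / 4) +
          |((b : ℝ) - a) - (b - a)| * q z < ((b : ℝ) - a) * ε := by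
      rw [sub_self, abs_zero, zero_mul]
      nlinarith
    filter_upwards [(tendsto_div_natCast_nhdsGT_zero ht).eventually
      (h (((b : ℝ) - a) * (ε / 4)) (by positivity)), hklim.eventually_lt_const hlt',
      hbound.eventually_lt_const hlt2] with n hn hn' hn2
    have c1 := hn _ _ _ (floor_mul_div_mono t n hac) (floor_mul_div_mono t n hcb)
      ((floor_mul_div_le ht b n).trans hbS) hn'.le
    change p (_ - _ - ((k n : ℝ) : 𝕜) • _) ≤ (k n : ℝ) * (ε / 4) + _ at c1
    have hne : (((b : ℝ) - a : ℝ) : 𝕜) ≠ 0 := by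
      rw [Ne, RCLike.ofReal_eq_zero]
      exact habR.ne'
    set X := (F (t / n) ^ ⌊(n : ℝ≥0) * b / t⌋₊) x - (F (t / n) ^ ⌊(n : ℝ≥0) * a / t⌋₊) x
    set G := (F (t / n) ^ ⌊(n : ℝ≥0) * c / t⌋₊) z with hG
    have c2 : p G ≤ q z := hb _ _ ((floor_mul_div_le ht c n).trans (hcb.trans hbS)) _
    have e : (((b : ℝ) - a : ℝ) : 𝕜)⁻¹ • X - G = (((b : ℝ) - a : ℝ) : 𝕜)⁻¹ •
        ((X - ((k n : ℝ) : 𝕜) • G) + (((k n : ℝ) - (b - a) : ℝ) : 𝕜) • G) := by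
      rw [RCLike.ofReal_sub (k n : ℝ), sub_smul, sub_add_sub_cancel, smul_sub _ X,
        inv_smul_smul₀ hne]
    rw [e, map_smul_eq_mul, norm_inv, RCLike.norm_ofReal, abs_of_pos habR,
      inv_mul_le_iff₀ habR]
    refine (map_add_le_add p _ _).trans ?_
    rw [map_smul_eq_mul, RCLike.norm_ofReal]
    have c3 : |(k n : ℝ) - (b - a)| * p G ≤ |(k n : ℝ) - (b - a)| * q z := by gcongr
    linarith
  refine ⟨η, hη, fun s s' hs hs' hne hlt => ?_⟩
  rcases lt_or_gt_of_ne hne with hlt' | hlt'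
  · have hR : (s' : ℝ) < s := by exact_mod_cast hlt'
    rw [abs_of_neg (sub_neg.2 hR)] at hlt
    filter_upwards [main s' s s hlt' hs (by linarith) hlt'.le le_rfl] with n hn
    rwa [← neg_sub (s : ℝ) s', RCLike.ofReal_neg, inv_neg, ← neg_sub _ ((F (t / n) ^ _) x),
      neg_smul_neg]
  · have hR : (s : ℝ) < s' := by exact_mod_cast hlt'
    rw [abs_of_pos (sub_pos.2 hR)] at hlt
    exact main s s' s hlt' hs' hlt le_rfl hlt'.le

/-- Condition (a) yields one subsequence along which the Chernoff products converge weakly at every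
time: the subsequence is extracted on a countable dense set of times, and equicontinuity in time
makes `φ` of the products Cauchy at the other times. -/
theorem CondA.exists_weak_limit (hF : ClassF F) {t : ℝ≥0} (ht : 0 < t) {l : ℝ≥0} (hl : 0 < l)
    {h : E} (hA : CondA F t l h) :
    ∃ k : ℕ → ℕ, StrictMono k ∧ ∀ s < l, ∃ x : E, ∀ φ : StrongDual 𝕜 E,
      Tendsto (fun n => φ ((F (t / k n) ^ ⌊(k n : ℝ≥0) * s / t⌋₊) h)) atTop (𝓝 (φ x)) := by
  let u : ℝ≥0 → ℕ → E := fun s n => (F (t / n) ^ ⌊(n : ℝ≥0) * s / t⌋₊) h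
  have : Nonempty (Set.Iio l) := ⟨⟨0, hl⟩⟩
  let d : ℕ → Set.Iio l := TopologicalSpace.denseSeq (Set.Iio l)
  have hd : DenseRange d := TopologicalSpace.denseRange_denseSeq _
  obtain ⟨k, hk, hconv⟩ := exists_strictMono_forall_tendsto
    (fun i n => toWeakSpace 𝕜 E (u (d i) n)) fun i k hk => by
      obtain ⟨j, hj, x, hx⟩ := hA (d i) (d i).2 k hk
      exact ⟨j, hj, toWeakSpace 𝕜 E x, hx⟩
  refine ⟨k, hk, fun s hs => ?_⟩
  obtain ⟨j, hj, x, hx⟩ := hA s hs k hk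
  refine ⟨x, fun φ => ?_⟩
  suffices hc : CauchySeq fun n => φ (u s (k n)) from
    tendsto_nhds_of_cauchySeq_of_subseq hc hj.tendsto_atTop (WeakTendsto.apply hx φ)
  rw [Metric.cauchySeq_iff]
  intro ε hε
  obtain ⟨η, hη, hcont⟩ := hF.exists_floor_pow_sub_le ht h (p := φ.toLinearMap.toSeminorm)
    φ.continuous.norm l (ε := ε / 4) (by positivity)
  obtain ⟨i, hi⟩ := hd.exists_dist_lt ⟨s, hs⟩ (ε := η) (by exact_mod_cast hη)
  have hi' : |(s : ℝ) - (d i : ℝ≥0)| < η := by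
    simpa [Subtype.dist_eq, NNReal.dist_eq] using hi
  have hclose : ∀ᶠ n in atTop, ‖φ (u s n) - φ (u (d i) n)‖ ≤ ε / 4 := by
    rcases le_total s (d i) with hle | hle
    · filter_upwards [hcont s (d i) hle (d i).2.le (by
        rw [← NNReal.coe_lt_coe, NNReal.coe_sub hle]
        exact (neg_sub (s : ℝ) _ ▸ neg_le_abs _).trans_lt hi')] with n hn
      rw [norm_sub_rev, ← map_sub]
      exact hn
    · filter_upwards [hcont (d i) s hle hs.le (by
        rw [← NNReal.coe_lt_coe, NNReal.coe_sub hle]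
        exact (le_abs_self _).trans_lt hi')] with n hn
      rw [← map_sub]
      exact hn
  obtain ⟨y, hy⟩ := hconv i
  have hcy : CauchySeq fun n => φ (u (d i) (k n)) :=
    (WeakTendsto.apply (𝕜 := 𝕜) (x := (toWeakSpace 𝕜 E).symm y) (by simpa [WeakTendsto] using hy)
      φ).cauchySeq
  obtain ⟨N₁, hN₁⟩ := Metric.cauchySeq_iff.1 hcy (ε / 4) (by positivity)
  obtain ⟨N₂, hN₂⟩ := eventually_atTop.1 (hk.tendsto_atTop.eventually hclose)
  refine ⟨max N₁ N₂, fun m hm n hn => ?_⟩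
  have c1 := hN₁ m (le_of_max_le_left hm) n (le_of_max_le_left hn)
  have c2 := hN₂ m (le_of_max_le_right hm)
  have c3 := hN₂ n (le_of_max_le_right hn)
  rw [← dist_eq_norm] at c2 c3
  rw [dist_comm] at c3
  have c4 := dist_triangle4 (φ (u s (k m))) (φ (u (d i) (k m))) (φ (u (d i) (k n))) (φ (u s (k n)))
  linarith

theorem CondB.mem_closure_domain {t l : ℝ≥0} {h : E} {Z : E →ₗ.[𝕜] E} (hZ : Z.IsClosable)
    (hB : CondB Z F t l h) {k : ℕ → ℕ} (hk : StrictMono k) {s : ℝ≥0} (hs : s < l) {x : E}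
    (hx : ∀ φ : StrongDual 𝕜 E,
      Tendsto (fun n => φ ((F (t / k n) ^ ⌊(k n : ℝ≥0) * s / t⌋₊) h)) atTop (𝓝 (φ x))) :
    x ∈ Z.closure.domain := by
  obtain ⟨g, hg, hgc⟩ := hB s hs
  obtain ⟨j, hj, y, hy⟩ := hgc k hk
  have hmem : (x, y) ∈ Z.closure.graph := by
    refine mem_of_forall_dual_tendsto_prod (l := atTop) (a := fun n => (g (k (j n)) : E))
      (b := fun n => Z.closure (g (k (j n)))) hZ.closure_isClosed
      (fun n => Z.closure.mem_graph _) (fun φ => ?_) (fun φ => hy.apply φ)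
    have h1 := (hx φ).comp hj.tendsto_atTop
    have h2 := (hg.apply φ).comp (hk.comp hj).tendsto_atTop
    have h3 := h1.sub h2
    rw [map_zero, sub_zero] at h3
    refine h3.congr fun n => ?_
    simp
  exact LinearPMap.mem_domain_of_mem_graph hmem

theorem exists_isLocalSolution [T2Space E] (hF : ClassF F) {Z : E →ₗ.[𝕜] E}
    (hZ : Z ≤ effDeriv F) (hD : StarDense (strongDerivDomain (adjointFun F)))
    {t : ℝ≥0} (ht : 0 < t) {l : ℝ≥0} (hl : 0 < l) {h : E} (hh : h ∈ Z.domain)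
    (hA : CondA F t l h) (hB : CondB Z F t l h) : ∃ f : ℝ≥0 → E, IsLocalSolution Z l h f := by
  obtain ⟨k, hk, hlim⟩ := hA.exists_weak_limit hF ht hl
  choose! f hf using hlim
  have hr : Tendsto (fun n => t / (k n : ℝ≥0)) atTop (𝓝[>] 0) :=
    (tendsto_div_natCast_nhdsGT_zero ht).comp hk.tendsto_atTop
  have hgraph : (h, Z ⟨h, hh⟩) ∈ mefDerivGraph F :=
    hF.graph_le_mefDerivGraph hZ (Z.mem_graph ⟨h, hh⟩)
  set z := Z ⟨h, hh⟩
  refine ⟨f, ?_, fun s hs => ?_⟩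
  · refine eq_of_forall_dual_eq (𝕜 := 𝕜) fun φ => tendsto_nhds_unique (hf 0 hl φ) ?_
    simp
  · have hdom := hB.mem_closure_domain (hF.isClosable hZ) hk hs (hf s hs)
    refine ⟨hdom, ?_⟩
    have hcl := hF.mem_closure_mefDerivGraph hZ ⟨f s, hdom⟩
    set y := Z.closure ⟨f s, hdom⟩
    have hnb : (𝓝[≠] s).NeBot := (nhdsGT_neBot s).mono (nhdsWithin_mono s fun _ hx => ne_of_gt hx)
    let T : ℝ≥0 → ℕ → E := fun v n => (F (t / k n) ^ ⌊(k n : ℝ≥0) * v / t⌋₊) h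
    let g : ℕ → E := fun n => (F (t / k n) ^ ⌊(k n : ℝ≥0) * s / t⌋₊) z
    have hslope : ∀ p : Seminorm 𝕜 E, Continuous p → ∀ ε > 0, ∀ᶠ v : ℝ≥0 in 𝓝[≠] s, v < l ∧
        ∀ᶠ n in atTop, p ((((v : ℝ) - s : ℝ) : 𝕜)⁻¹ • (T v n - T s n) - g n) ≤ ε := by
      intro p hp ε hε
      obtain ⟨η, hη, hη'⟩ := hF.exists_slope_floor_pow_sub_le ht (subset_closure hgraph) hp l hε
      filter_upwards [self_mem_nhdsWithin, nhdsWithin_le_nhds (Iio_mem_nhds hs),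
        nhdsWithin_le_nhds (Metric.ball_mem_nhds s (show (0 : ℝ) < η by exact_mod_cast hη))]
        with v hv hvl hvη
      exact ⟨hvl, hk.tendsto_atTop.eventually (hη' s v hs.le (le_of_lt hvl) hv hvη)⟩
    have hweak : ∀ v < l, ∀ φ : StrongDual 𝕜 E,
        Tendsto (fun n => φ ((((v : ℝ) - s : ℝ) : 𝕜)⁻¹ • (T v n - T s n))) atTop
          (𝓝 (φ ((((v : ℝ) - s : ℝ) : 𝕜)⁻¹ • (f v - f s)))) := by
      intro v hv φ
      simp only [map_smul, map_sub]
      exact ((hf v hv φ).sub (hf s hs φ)).const_smul _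
    refine hD.tendsto_of_seminorm_cauchy ?_ ?_
    · intro p hp ε hε
      refine ⟨_, hslope p hp (ε / 2) (by positivity), fun v hv w hw => ?_⟩
      refine seminorm_le_of_forall_dual_tendsto (l := atTop)
        (u := fun n => (((v : ℝ) - s : ℝ) : 𝕜)⁻¹ • (T v n - T s n) -
          (((w : ℝ) - s : ℝ) : 𝕜)⁻¹ • (T w n - T s n)) (fun φ => ?_) hp ?_
      · simp only [map_sub φ (_ • _)]
        exact (hweak v hv.1 φ).sub (hweak w hw.1 φ)
      · filter_upwards [hv.2, hw.2] with n h1 h2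
        rw [← sub_sub_sub_cancel_right _ _ (g n)]
        exact (map_sub_le_add p _ _).trans (by linarith)
    · rintro φ ⟨ψ, hψ⟩
      have hg : Tendsto (fun n => φ (g n)) atTop (𝓝 (φ y)) := by
        have h1 := hF.1.tendsto_apply_pow_sub hψ hgraph hr
          (m := fun n => ⌊(k n : ℝ≥0) * s / t⌋₊) (S := s) fun n => floor_mul_div_le ht s (k n)
        have h2 := h1.add (hf s hs ψ)
        rw [zero_add, ← apply_eq_of_mem_closure_mefDerivGraph hψ hcl] at h2
        exact h2.congr fun n => sub_add_cancel _ _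
      rw [Metric.tendsto_nhds]
      intro ε hε
      filter_upwards [hslope φ.toLinearMap.toSeminorm φ.continuous.norm (ε / 2) (by positivity)]
        with v hv
      have h1 := ((hweak v hv.1 φ).sub hg).norm
      rw [dist_eq_norm]
      refine (le_of_tendsto h1 ?_).trans_lt (show ε / 2 < ε by linarith)
      filter_upwards [hv.2] with n hn
      rw [← map_sub]
      exact hn

theorem condA_of_isLocalSolution [T2Space E] (hF : ClassF F) {Z : E →ₗ.[𝕜] E}
    (hZ : Z ≤ effDeriv F) {t : ℝ≥0} (ht : 0 < t) {l : ℝ≥0} {h : E} {f : ℝ≥0 → E}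
    (hf : IsLocalSolution Z l h f) : CondA F t l h := fun s hs _ hk =>
  ⟨id, strictMono_id, f s, weakTendsto_of_tendsto
    ((tendsto_pow_floor_of_isLocalSolution hF hZ hf ht hs).comp hk.tendsto_atTop)⟩

theorem condB_of_isLocalSolution [T2Space E] (hF : ClassF F) {Z : E →ₗ.[𝕜] E}
    (hZ : Z ≤ effDeriv F) {t : ℝ≥0} (ht : 0 < t) {l : ℝ≥0} {h : E} {f : ℝ≥0 → E}
    (hf : IsLocalSolution Z l h f) : CondB Z F t l h := fun s hs => by
  refine ⟨fun _ => ⟨f s, (hf.2 s hs).1⟩, weakTendsto_of_tendsto ?_, fun _ _ =>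
    ⟨id, strictMono_id, _, weakTendsto_of_tendsto tendsto_const_nhds⟩⟩
  have := (tendsto_pow_floor_of_isLocalSolution hF hZ hf ht hs).sub_const (f s)
  rwa [sub_self] at this

theorem tendsto_pow_of_isLocalSolution [T2Space E] (hF : ClassF F) {Z : E →ₗ.[𝕜] E}
    (hZ : Z ≤ effDeriv F) {l : ℝ≥0} {h : E} {f : ℝ≥0 → E} (hf : IsLocalSolution Z l h f)
    {v : ℝ≥0} (hv : v < l) :
    Tendsto (fun n : ℕ => (F (v / n) ^ n) h) atTop (𝓝 (f v)) := by
  rcases eq_zero_or_pos v with rfl | hv0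
  · simp [hF.1.1, hf.1, ← ContinuousLinearMap.one_def]
  · refine (tendsto_pow_floor_of_isLocalSolution hF hZ hf hv0 hv).congr fun n => ?_
    rw [mul_div_cancel_right₀ _ hv0.ne', Nat.floor_natCast]

end Existence

end ChernoffLCS

theorem theorem7p1 {𝕜 X : Type*} [RCLike 𝕜] [AddCommGroup X] [Module 𝕜 X]
    [UniformSpace X] [IsUniformAddGroup X] [ContinuousSMul 𝕜 X] [PolynormableSpace 𝕜 X] [T2Space X]
    (Z : X →ₗ.[𝕜] X) (hZ : ChernoffLCS.ClassZ Z) (t : ℝ≥0) (ht : 0 < t)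
    (F : ℝ≥0 → X →L[𝕜] X) (hF : ChernoffLCS.ClassF F)
    (hi : Z ≤ ChernoffLCS.effDeriv F)
    (hii : ChernoffLCS.StarDense
      (ChernoffLCS.strongDerivDomain (ChernoffLCS.adjointFun F)))
    (l : ℝ≥0) (hl : 0 < l) (h : X) (hh : h ∈ Z.domain) :
    ChernoffLCS.EffDerivExists F ∧ Z.IsClosable ∧
    ((∃ f : ℝ≥0 → X, ChernoffLCS.IsLocalSolution Z l h f) ↔
      ChernoffLCS.CondA F t l h ∧ ChernoffLCS.CondB Z F t l h) ∧
    (ChernoffLCS.CondA F t l h ∧ ChernoffLCS.CondB Z F t l h →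
      ∀ f : ℝ≥0 → X, ChernoffLCS.IsLocalSolution Z l h f →
        ∀ v : ℝ≥0, v < l → Tendsto (fun n : ℕ => (F (v / n) ^ n) h) atTop (𝓝 (f v))) :=
  ⟨hF.effDerivExists, hF.isClosable hi,
    ⟨fun ⟨_, hf⟩ => ⟨ChernoffLCS.condA_of_isLocalSolution hF hi ht hf,
      ChernoffLCS.condB_of_isLocalSolution hF hi ht hf⟩,
    fun ⟨hA, hB⟩ => ChernoffLCS.exists_isLocalSolution hF hi hii ht hl hh hA hB⟩,
    fun _ _ hf _ hv => ChernoffLCS.tendsto_pow_of_isLocalSolution hF hi hf hv⟩
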